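/- **Proposition (Strict dominance when $\epsilon\to0$).** A principal and $n\ge 2$ agents decide on a project, which is launched iff the principal proposes it and at least $k\le n$ agents accept. The state $\theta\in\Theta=[-1,1]$ has an atomless prior $F$. Without a launch all payoffs from the project are $0$; a launch gives the principal $u(\theta)=\theta$ and agent $i$ $v_i(\theta)=\alpha_i\theta+\beta_i$ with $\alpha_i\in\{-1,1\}$, $\beta_i\in(-1,1)$. The acceptance thresholds $\delta_i=-\beta_i/\alpha_i$ are pairwise distinct, and $\delta_i\ne 0$ whenever $\alpha_i=-1$. *Game.* The principal publicly chooses a test $t=(\mathcal S,\pi)$ (a measurable signal space and a Markov kernel from $\Theta$ to $\mathcal S$) and privately observes $s\sim\pi(\cdot\mid\theta)$. She then proposes or forgoes the project; a proposal costs her $c>0$. After a proposal she sends cheap-talk messages $m_i\in\mathcal M$ to the agents, where $\mathcal M$ is a measurable space with $2^{\mathcal S}\subseteq\mathcal M$ in which reports $s\mapsto\{s\}$ are measurably embedded. Under *public messaging* all agents commonly receive one and the same message; under *private messaging* the profile $(m_1,\dots,m_n)$ is arbitrary and agent $i$ sees only $m_i$. Independently across agents, each agent is mechanical with probability $\epsilon>0$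 (he then accepts with probability $1/2$) and otherwise rational. The solution concept is weak perfect Bayesian equilibrium of the continuation game after $t$ (sequential rationality at every information set, Bayes' rule on path, arbitrary beliefs off path). An equilibrium induces an outcome $\omega=(\omega_p,\omega_\ell):\Theta\to[0,1]^2$, the probability of a proposal and the probability of a launch conditional on a proposal. Let $U_{\mathsf{pub}}(F,c,\epsilon)$ and $U_{\mathsf{pri}}(F,c,\epsilon)$ be the suprema, over all tests and all equilibrium outcomes under public, respectively private, messaging, of $\int_\Theta(\theta\,\omega_\ell(\theta)-c)\,\omega_p(\theta)\,dF(\theta)$. *Notation.* Let $\mathcal A_i=[-1,\delta_i]$ if $\alpha_i=-1$ and $\mathcal A_i=[\delta_i,1]$ if $\alpha_i=1$, and let $a(\mu)=\#\{i:\mu\in\mathcal A_i\}$. The set of possible numbers of approvals by rational agents at posterior mean $\mu$ is $N(\mu)=\{a(\mu)\}$ if $\mu\ne\delta_i$ for all $i$, and $N(\mu)=\{a(\mu),a(\mu)-1\}$ otherwise. *Claim.* The following are equivalent. (a) There are an atomless prior $F$ and a cost $c>0$ such that public messaging is strictly better than private messaging for all sufficiently small $\epsilon$, with an advantage that does not vanish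 as $\epsilon\to0$: there are $\eta>0$ and $\epsilon_0>0$ with $U_{\mathsf{pub}}(F,c,\epsilon)\ge U_{\mathsf{pri}}(F,c,\epsilon)+\eta$ for all $\epsilon\in(0,\epsilon_0)$. (b) The set $\Lambda=\{\theta\in[0,1]:\max N(\theta)\ge k\}$ is not convex. -/

import Mathlib

open MeasureTheory ProbabilityTheory Filter Topology

noncomputable section

/-- The state space `Θ = [-1, 1]`. -/
abbrev State : Type := Set.Icc (-1 : ℝ) 1

/-- A test: a measurable signal space and a rule mapping states to signal distributions. -/
structure Test where
  S : Type
  [measurableSpace : MeasurableSpace S]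
  π : Kernel State S
  [isMarkov : IsMarkovKernel π]

attribute [instance] Test.measurableSpace Test.isMarkov

/-- A message space available with the test `t`: a measurable space that includes the power set
of the signal space and in which a truthful report of the signal, `s ↦ {s}`, is measurable and
measurably decodable. -/
structure MessageSpace (t : Test) where
  M : Type
  [measurableSpace : MeasurableSpace M]
  incl : Set t.S → M
  incl_injective : Function.Injective incl
  measurableEmbedding_report : MeasurableEmbedding (fun s : t.S => incl {s})

attribute [instance] MessageSpace.measurableSpace

/-- A communication regime for `n` agents with messages in `M`: the principal chooses a point
of `X`, and agent `i` sees only the message `obs i x`. -/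
structure Channel (n : ℕ) (M : Type) [MeasurableSpace M] where
  X : Type
  [measurableSpace : MeasurableSpace X]
  obs : Fin n → X → M
  measurable_obs : ∀ i, Measurable (obs i)

attribute [instance] Channel.measurableSpace

/-- Public messaging: one common message, seen by every agent. -/
def publicChannel (n : ℕ) (M : Type) [MeasurableSpace M] : Channel n M where
  X := M
  obs := fun _ m => m
  measurable_obs := fun _ => measurable_id

/-- Private messaging: an arbitrary message profile, of which agent `i` sees entry `i`. -/
def privateChannel (n : ℕ) (M : Type) [MeasurableSpace M] : Channel n M where
  X := Fin n → M
  obs := fun i x => x i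
  measurable_obs := fun i => measurable_pi_apply i

/-- The probability that at least `k` of `n` agents accept when they accept independently,
agent `i` with probability `p i`. -/
def launchProb {n : ℕ} (k : ℕ) (p : Fin n → ℝ) : ℝ :=
  ∑ A : Finset (Fin n) with k ≤ A.card, (∏ i ∈ A, p i) * ∏ i ∈ Aᶜ, (1 - p i)

/-- The data of the game with `n` agents: number `k` of acceptances needed for launching, payoffs
`u` and `v i` of the principal and of agent `i` from launching, prior `F`, proposal cost `c`, and
probability `ε` that an agent is mechanical. -/
structure Game (n : ℕ) where
  k : ℕ
  u : State → ℝ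
  v : Fin n → State → ℝ
  F : Measure State
  c : ℝ
  ε : ℝ

/-- Strategies and beliefs in the continuation game after the test `t`.
* `γ s`: probability of proposing after the signal `s`;
* `σ s`: distribution of the message profile sent after the signal `s` and a proposal;
* `τ i m`: acceptance probability of a rational agent `i` after the message `m`;
* `φ s`: belief of the principal about the state after the signal `s`;
* `ψ i m`: belief of agent `i`, after a proposal and the message `m`, about the state and about
  the profile that was sent (its first marginal is his belief about the state). -/
structure Assessment {n : ℕ} {M : Type} [MeasurableSpace M] (t : Test) (C : Channel n M) where
  γ : t.S → unitInterval
  measurable_γ : Measurable γ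
  σ : Kernel t.S C.X
  isMarkov_σ : IsMarkovKernel σ
  τ : Fin n → M → unitInterval
  measurable_τ : ∀ i, Measurable (τ i)
  φ : Kernel t.S State
  isMarkov_φ : IsMarkovKernel φ
  ψ : Fin n → Kernel M (State × C.X)
  isMarkov_ψ : ∀ i, IsMarkovKernel (ψ i)

/-- An outcome: in each state, the probability that the project is proposed, and the probability
that it is launched conditional on being proposed. -/
structure Outcome where
  proposed : State → unitInterval
  launched : State → unitInterval

namespace Game

variable {n : ℕ} (G : Game n)

section Continuation

variable {M : Type} [MeasurableSpace M] {t : Test} {C : Channel n M} (ρ : Assessment t C)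

/-- Actual acceptance probability of agent `i` after the message `m`, trembles included. -/
def accept (i : Fin n) (m : M) : ℝ := (1 - G.ε) * (ρ.τ i m : ℝ) + G.ε / 2

/-- Probability of a launch, given a proposal and the choice `x` of the principal. -/
def launch (x : C.X) : ℝ := launchProb G.k (fun i => G.accept ρ i (C.obs i x))

/-- Expected payoff of the principal if she proposes after the signal `s` and then sends
messages according to `σ s`. -/
def proposePayoff (s : t.S) : ℝ :=
  (∫ θ, G.u θ ∂(ρ.φ s)) * (∫ x, G.launch ρ x ∂(ρ.σ s)) - G.c

/-- Expected payoff of a rational agent `i` who has received `m` and accepts with probability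
`a`, the other agents following `ρ`. -/
def votePayoff (i : Fin n) (m : M) (a : ℝ) : ℝ :=
  ∫ p, G.v i p.1 *
    launchProb G.k (Function.update (fun j => G.accept ρ j (C.obs j p.2)) i a) ∂(ρ.ψ i m)

/-- Joint law of the state and of the profile sent, on the event that the project is proposed
(its total mass is the probability of a proposal). -/
def proposalLaw : Measure (State × C.X) :=
  (((G.F ⊗ₘ t.π).withDensity (fun q => ENNReal.ofReal (ρ.γ q.2))) ⊗ₘ
    (ρ.σ.prodMkLeft State)).map (fun q => (q.1.1, q.2))

/-- Weak perfect Bayesian equilibrium of the continuation game. -/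
structure IsEquilibrium : Prop where
  /-- The principal's belief is the conditional law of the state given the signal. -/
  principal_bayes : (G.F ⊗ₘ t.π).map Prod.swap = (G.F.bind t.π) ⊗ₘ ρ.φ
  /-- Agent `i`'s belief is the conditional law given a proposal and his message. It is
  unrestricted on sets of messages that are sent with probability zero. -/
  agent_bayes : ∀ i, (G.proposalLaw ρ).map (fun p => (C.obs i p.2, p)) =
    ((G.proposalLaw ρ).map (fun p => C.obs i p.2)) ⊗ₘ ρ.ψ i
  /-- On and off path, an agent knows the message that he has received. -/
  agent_knows : ∀ i m, (ρ.ψ i m).map (fun p => C.obs i p.2) = Measure.dirac m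
  /-- After every signal and a proposal, no message profile is a profitable deviation. -/
  message_optimal : ∀ s x,
    (∫ θ, G.u θ ∂(ρ.φ s)) * G.launch ρ x - G.c ≤ G.proposePayoff ρ s
  /-- After every signal, the proposal probability is optimal. -/
  propose_optimal : ∀ s, ∀ g : unitInterval,
    (g : ℝ) * G.proposePayoff ρ s ≤ (ρ.γ s : ℝ) * G.proposePayoff ρ s
  /-- After every message, each rational agent's vote is optimal. -/
  vote_optimal : ∀ i m, ∀ a : unitInterval,
    G.votePayoff ρ i m a ≤ G.votePayoff ρ i m (ρ.τ i m)

/-- The assessment `ρ` induces the outcome `ω`. The conditional launch probability is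
unrestricted at states where the project is never proposed. -/
def Induces (ω : Outcome) : Prop :=
  ∀ θ, (ω.proposed θ : ℝ) = ∫ s, (ρ.γ s : ℝ) ∂(t.π θ) ∧
    (ω.proposed θ : ℝ) * (ω.launched θ : ℝ) =
      ∫ s, (ρ.γ s : ℝ) * ∫ x, G.launch ρ x ∂(ρ.σ s) ∂(t.π θ)

end Continuation

/-- The outcomes that are implementable with the test `t` in the regime `C`. -/
def implementable {M : Type} [MeasurableSpace M] (t : Test) (C : Channel n M) : Set Outcome :=
  {ω | ∃ ρ : Assessment t C, G.IsEquilibrium ρ ∧ G.Induces ρ ω}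

/-- The principal's ex ante payoff from an outcome. -/
def payoff (ω : Outcome) : ℝ :=
  ∫ θ, (G.u θ * (ω.launched θ : ℝ) - G.c) * (ω.proposed θ : ℝ) ∂G.F

/-- The principal's optimal payoff, over all tests and equilibria, under public messaging. -/
def publicValue (𝓜 : ∀ t : Test, MessageSpace t) : ℝ :=
  sSup {y | ∃ t : Test, ∃ ω ∈ G.implementable t (publicChannel n (𝓜 t).M), y = G.payoff ω}

/-- The principal's optimal payoff, over all tests and equilibria, under private messaging. -/
def privateValue (𝓜 : ∀ t : Test, MessageSpace t) : ℝ :=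
  sSup {y | ∃ t : Test, ∃ ω ∈ G.implementable t (privateChannel n (𝓜 t).M), y = G.payoff ω}

end Game

/-- The game of the linear environment: `u θ = θ` and `v i θ = α i * θ + β i`. -/
def linearGame {n : ℕ} (k : ℕ) (α β : Fin n → ℝ) (F : Measure State) (c ε : ℝ) : Game n where
  k := k
  u := fun θ => θ
  v := fun i θ => α i * θ + β i
  F := F
  c := c
  ε := ε

/-- Acceptance threshold `δ i = - β i / α i`. -/
def threshold {n : ℕ} (α β : Fin n → ℝ) (i : Fin n) : ℝ := -β i / α i

/-- Approval region: `[-1, δ i]` if `α i = -1`, and `[δ i, 1]` otherwise (if `α i = 1`). -/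
def approvalRegion {n : ℕ} (α β : Fin n → ℝ) (i : Fin n) : Set ℝ :=
  open Classical in
  if α i = -1 then Set.Icc (-1) (threshold α β i) else Set.Icc (threshold α β i) 1

/-- The number of agents whose approval region contains `μ`. -/
def approvalCount {n : ℕ} (α β : Fin n → ℝ) (μ : ℝ) : ℕ :=
  Set.ncard {i : Fin n | μ ∈ approvalRegion α β i}

/-- `N(μ)`: the possible numbers of approvals from rational agents at the posterior mean `μ`. -/
def approvalNumbers {n : ℕ} (α β : Fin n → ℝ) (μ : ℝ) : Finset ℕ :=
  open Classical in
  if ∀ i, μ ≠ threshold α β i then {approvalCount α β μ}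
  else {approvalCount α β μ, approvalCount α β μ - 1}

/-- `Λ = {θ ∈ [0,1] : max N(θ) ≥ k}`; the supremum of the finite nonempty set `N(θ)` of natural
numbers is its maximum. -/
def launchSet {n : ℕ} (k : ℕ) (α β : Fin n → ℝ) : Set ℝ :=
  {θ | θ ∈ Set.Icc (0 : ℝ) 1 ∧ k ≤ (approvalNumbers α β θ).sup id}

end

/-! A proposal is worth its cost only at a positive posterior mean, where the principal strictly
prefers a likelier launch. Hence every message profile sent on path attains one and the same launch
probability $V$, the maximum over all profiles. An equilibrium enters her payoff only through $V$,
the proposal probability $P$ and $T=\int\theta\,\omega_p\,dF$: the payoff is $VT-cP$ (`payoff_eq`).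
Optimality of forgoing gives $VT_0\le cP_0$ for the complementary quantities $T_0,P_0$
(`forgone_le`). The trembles make every agent pivotal with positive probability, so a rational agent
who may accept must approve at his posterior mean. If $V>n\epsilon/2$, trembles alone cannot explain
the launches, and at least $k$ rational agents may accept. Under private messaging each agent must
on path receive a message that maximizes his own acceptance probability; averaging over his messages
yields $T/P\in\Lambda$ when the payoffs are those of the linear environment and states are positive
enough for $T\ge 0$ (`le_card_approving_private`). Under public messaging only the mean after each
message lies in $\Lambda$, and $T/P$ is an average of such means (`mem_launchSet_public`). If
$\Lambda$ is convex, $T/P\in\Lambda$ under public messaging too. An uninformative private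
equilibrium then imitates the public one up to $n\epsilon$ (`le_privateValue_add`). The obstacle is
that the imitation may raise the launch probability and tempt her to propose at forgone signals. In
that case forgone states are pooled into the proposal, either entirely or up to a boundary point of
$\Lambda$, where one indifferent agent is decisive and his mixing tunes the launch probability. If
$\Lambda$ is not convex, it has a gap with endpoints $x<y$ at which exactly $k$ agents approve. Take
a prior with half its mass near each endpoint, so that the prior mean lies in the gap. Publicly
telling the halves apart is credible, because equal numbers of approvals give equal launch
probabilities, and the project is almost always launched (`le_publicValue_of_gap`). Under private
messaging $T/P$ must avoid the gap, so profitable states are forgone with a probability bounded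
below, uniformly in $\epsilon$ (`privateValue_le_of_gap`). -/

section LaunchProb

/-! ### The launch probability as a function of the acceptance probabilities. -/

variable {n : ℕ} {k : ℕ}

theorem sum_prod_mul_prod_compl (p q : Fin n → ℝ) :
    ∑ A : Finset (Fin n), (∏ i ∈ A, p i) * ∏ i ∈ Aᶜ, q i = ∏ i, (p i + q i) := by
  rw [Finset.prod_add, Finset.powerset_univ]
  simp only [Finset.compl_eq_univ_sdiff]

/-- The probability that agent `i` is pivotal. -/
def pivotProb (k : ℕ) (p : Fin n → ℝ) (i : Fin n) : ℝ :=
  ∑ A ∈ (Finset.univ.erase i).powerset with A.card + 1 = k,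
    (∏ j ∈ A, p j) * ∏ j ∈ Finset.univ.erase i \ A, (1 - p j)

/-- The probability that at least `k` agents other than `i` accept. -/
def launchWithout (k : ℕ) (p : Fin n → ℝ) (i : Fin n) : ℝ :=
  ∑ A ∈ (Finset.univ.erase i).powerset with k ≤ A.card,
    (∏ j ∈ A, p j) * ∏ j ∈ Finset.univ.erase i \ A, (1 - p j)

/-- Affinity in each coordinate, with the pivot probability as slope: this reduces a vote to the
sign of an expected payoff, and lets the principal gain by raising one agent's acceptance. -/
theorem launchProb_update (p : Fin n → ℝ) (i : Fin n) (a : ℝ) :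
    launchProb k (Function.update p i a) = launchWithout k p i + a * pivotProb k p i := by
  have hi : i ∉ Finset.univ.erase i := by simp
  have hu : (Finset.univ : Finset (Finset (Fin n))) =
      (insert i (Finset.univ.erase i)).powerset := by
    rw [Finset.insert_erase (Finset.mem_univ i), Finset.powerset_univ]
  unfold launchProb launchWithout pivotProb
  rw [Finset.sum_filter, Finset.sum_filter, Finset.sum_filter, hu,
    Finset.sum_powerset_insert hi, Finset.mul_sum, ← Finset.sum_add_distrib,
    ← Finset.sum_add_distrib]
  refine Finset.sum_congr rfl fun A hA => ?_
  have hiA : i ∉ A := fun h => hi (Finset.mem_powerset.1 hA h)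
  have h1 : ∏ j ∈ A, Function.update p i a j = ∏ j ∈ A, p j :=
    Finset.prod_congr rfl fun j hj => Function.update_of_ne (ne_of_mem_of_not_mem hj hiA) _ _
  have h2 : ∏ j ∈ Finset.univ.erase i \ A, (1 - Function.update p i a j) =
      ∏ j ∈ Finset.univ.erase i \ A, (1 - p j) :=
    Finset.prod_congr rfl fun j hj => by
      rw [Function.update_of_ne (Finset.ne_of_mem_erase (Finset.mem_sdiff.1 hj).1)]
  have h3 : Aᶜ = insert i (Finset.univ.erase i \ A) := by
    ext j; by_cases hj : j = i <;> simp_all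
  have h4 : (insert i A)ᶜ = Finset.univ.erase i \ A := by
    ext j; by_cases hj : j = i <;> simp_all
  rw [h4, h3, Finset.prod_insert (by simp), Finset.prod_insert hiA, h1, h2,
    Finset.card_insert_of_notMem hiA, Function.update_self]
  rcases lt_trichotomy k (A.card + 1) with h | h | h
  · rw [if_pos (show k ≤ A.card by omega), if_pos (show k ≤ A.card + 1 by omega),
      if_neg (show ¬ A.card + 1 = k by omega), if_pos (show k ≤ A.card by omega)]
    ring
  · rw [if_neg (show ¬ k ≤ A.card by omega), if_pos (show k ≤ A.card + 1 by omega),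
      if_pos (show A.card + 1 = k by omega), if_neg (show ¬ k ≤ A.card by omega)]
    ring
  · rw [if_neg (show ¬ k ≤ A.card by omega), if_neg (show ¬ k ≤ A.card + 1 by omega),
      if_neg (show ¬ A.card + 1 = k by omega), if_neg (show ¬ k ≤ A.card by omega)]
    ring

theorem pivotProb_nonneg {p : Fin n → ℝ} (hp : ∀ i, p i ∈ Set.Icc (0 : ℝ) 1) (i : Fin n) :
    0 ≤ pivotProb k p i :=
  Finset.sum_nonneg fun _ _ => mul_nonneg (Finset.prod_nonneg fun j _ => (hp j).1)
    (Finset.prod_nonneg fun j _ => sub_nonneg.2 (hp j).2)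

theorem pivotProb_pos {p : Fin n → ℝ} (hk : 1 ≤ k) (hkn : k ≤ n)
    (hp : ∀ i, p i ∈ Set.Ioo (0 : ℝ) 1) (i : Fin n) : 0 < pivotProb k p i := by
  refine Finset.sum_pos (fun _ _ => mul_pos (Finset.prod_pos fun j _ => (hp j).1)
    (Finset.prod_pos fun j _ => sub_pos.2 (hp j).2)) ?_
  obtain ⟨A, hA, hc⟩ := Finset.exists_subset_card_eq (s := Finset.univ.erase i) (n := k - 1)
    (by rw [Finset.card_erase_of_mem (Finset.mem_univ i), Finset.card_univ, Fintype.card_fin]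
        omega)
  exact ⟨A, by rw [Finset.mem_filter, Finset.mem_powerset]; exact ⟨hA, by omega⟩⟩

theorem launchProb_nonneg {p : Fin n → ℝ} (hp : ∀ i, p i ∈ Set.Icc (0 : ℝ) 1) :
    0 ≤ launchProb k p :=
  Finset.sum_nonneg fun _ _ => mul_nonneg (Finset.prod_nonneg fun j _ => (hp j).1)
    (Finset.prod_nonneg fun j _ => sub_nonneg.2 (hp j).2)

/-- A union bound: with fewer than `k` agents in `S`, a launch needs an acceptance from outside `S`.
-/
theorem launchProb_le_sum_compl {p : Fin n → ℝ} (hp : ∀ i, p i ∈ Set.Icc (0 : ℝ) 1)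
    {S : Finset (Fin n)} (hS : S.card < k) : launchProb k p ≤ ∑ j ∈ Sᶜ, p j := by
  have hw : ∀ A : Finset (Fin n), 0 ≤ (∏ i ∈ A, p i) * ∏ i ∈ Aᶜ, (1 - p i) := fun A =>
    mul_nonneg (Finset.prod_nonneg fun j _ => (hp j).1)
      (Finset.prod_nonneg fun j _ => sub_nonneg.2 (hp j).2)
  have hj : ∀ j, p j = ∑ A : Finset (Fin n) with j ∈ A,
      (∏ i ∈ A, p i) * ∏ i ∈ Aᶜ, (1 - p i) := by
    intro j
    -- Setting the rejection weight of `j` to zero kills exactly the terms in which `j` is not in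
    -- `A`.
    have h := sum_prod_mul_prod_compl p (Function.update (fun i => 1 - p i) j 0)
    rw [Finset.prod_eq_single j (fun i _ hi => by rw [Function.update_of_ne hi]; ring)
      (by simp), Function.update_self, add_zero] at h
    rw [← h, Finset.sum_filter]
    refine Finset.sum_congr rfl fun A _ => ?_
    by_cases hA : j ∈ A
    · rw [if_pos hA]
      congr 1
      exact Finset.prod_congr rfl fun i hi => by
        rw [Function.update_of_ne (ne_of_mem_of_not_mem hA (Finset.mem_compl.1 hi)).symm]
    · rw [if_neg hA, Finset.prod_eq_zero (i := j) (s := Aᶜ) (by simpa using hA) (by simp),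
        mul_zero]
  calc launchProb k p
      ≤ ∑ A : Finset (Fin n), ∑ j ∈ Sᶜ, if j ∈ A then
          (∏ i ∈ A, p i) * ∏ i ∈ Aᶜ, (1 - p i) else 0 := by
        unfold launchProb
        rw [Finset.sum_filter]
        refine Finset.sum_le_sum fun A _ => ?_
        have h0 : ∀ j ∈ Sᶜ, 0 ≤ if j ∈ A then
            (∏ i ∈ A, p i) * ∏ i ∈ Aᶜ, (1 - p i) else 0 := fun j _ => by
          split_ifs
          exacts [hw A, le_rfl]
        split_ifs with hA
        · obtain ⟨j, hjA, hjS⟩ :=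
            Finset.exists_mem_notMem_of_card_lt_card (lt_of_lt_of_le hS hA)
          refine le_trans (le_of_eq ?_) (Finset.single_le_sum h0 (Finset.mem_compl.2 hjS))
          rw [if_pos hjA]
        · exact Finset.sum_nonneg h0
    _ = ∑ j ∈ Sᶜ, ∑ A : Finset (Fin n) with j ∈ A,
          (∏ i ∈ A, p i) * ∏ i ∈ Aᶜ, (1 - p i) := by
        rw [Finset.sum_comm]
        simp only [Finset.sum_filter]
    _ = ∑ j ∈ Sᶜ, p j := Finset.sum_congr rfl fun j _ => (hj j).symm

/-- Fewer than `k` acceptances means at least `n + 1 - k` rejections; this duality turns upper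
bounds into lower bounds. -/
theorem launchProb_eq_one_sub {p : Fin n → ℝ} (hkn : k ≤ n) :
    launchProb k p = 1 - launchProb (n + 1 - k) (fun i => 1 - p i) := by
  have h := sum_prod_mul_prod_compl p (fun i => 1 - p i)
  simp only [add_sub_cancel, Finset.prod_const_one] at h
  rw [eq_sub_iff_add_eq]
  refine Eq.trans ?_ h
  rw [← Finset.sum_filter_add_sum_filter_not Finset.univ (fun A : Finset (Fin n) => k ≤ A.card)]
  unfold launchProb
  congr 1
  refine Finset.sum_bij' (fun A _ => Aᶜ) (fun A _ => Aᶜ) ?_ ?_ ?_ ?_ ?_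
  · intro A hA
    have := (Finset.mem_filter.1 hA).2
    have hc := Finset.card_compl A
    have := Finset.card_le_univ A
    simp only [Fintype.card_fin] at *
    simp only [Finset.mem_filter, Finset.mem_univ, true_and]
    omega
  · intro A hA
    have := (Finset.mem_filter.1 hA).2
    have hc := Finset.card_compl A
    have := Finset.card_le_univ A
    simp only [Fintype.card_fin] at *
    simp only [Finset.mem_filter, Finset.mem_univ, true_and]
    omega
  · simp
  · simp
  · intro A _
    simp only [compl_compl, sub_sub_cancel]
    rw [mul_comm]

theorem launchProb_le_one {p : Fin n → ℝ} (hkn : k ≤ n) (hp : ∀ i, p i ∈ Set.Icc (0 : ℝ) 1) :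
    launchProb k p ≤ 1 := by
  rw [launchProb_eq_one_sub hkn]
  have := launchProb_nonneg (k := n + 1 - k) (p := fun i => 1 - p i)
    (fun i => ⟨by linarith [(hp i).2], by linarith [(hp i).1]⟩)
  linarith

theorem one_sub_sum_le_launchProb {p : Fin n → ℝ} (hkn : k ≤ n)
    (hp : ∀ i, p i ∈ Set.Icc (0 : ℝ) 1) {S : Finset (Fin n)} (hS : k ≤ S.card) :
    1 - ∑ j ∈ S, (1 - p j) ≤ launchProb k p := by
  rw [launchProb_eq_one_sub hkn]
  have := launchProb_le_sum_compl (k := n + 1 - k) (p := fun i => 1 - p i) (S := Sᶜ)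
    (fun i => ⟨by linarith [(hp i).2], by linarith [(hp i).1]⟩)
    (by rw [Finset.card_compl, Fintype.card_fin]; have := Finset.card_le_univ S
        rw [Fintype.card_fin] at this; omega)
  rw [compl_compl] at this
  linarith

theorem continuous_launchProb : Continuous (launchProb (n := n) k) := by
  unfold launchProb
  fun_prop

/-- Anonymity of the voting rule; it is what makes two signals with different supporters equally
attractive to the principal. -/
theorem launchProb_comp_perm (p : Fin n → ℝ) (e : Equiv.Perm (Fin n)) :
    launchProb k (p ∘ e) = launchProb k p := by
  unfold launchProb
  rw [Finset.sum_filter, Finset.sum_filter]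
  refine Eq.trans ?_ (Equiv.sum_comp e.finsetCongr _)
  refine Finset.sum_congr rfl fun A _ => ?_
  have h : (e.finsetCongr A)ᶜ = e.finsetCongr Aᶜ := by
    ext j
    simp [Finset.mem_map_equiv]
  rw [h]
  simp [Equiv.finsetCongr_apply, Finset.prod_map]

theorem exists_perm_mem_iff {S T : Finset (Fin n)} (h : S.card = T.card) :
    ∃ e : Equiv.Perm (Fin n), ∀ i, e i ∈ T ↔ i ∈ S := by
  let e := (Finset.equivOfCardEq h).extendSubtype
  refine ⟨e, fun i => ⟨fun hi => ?_, fun hi => ?_⟩⟩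
  · by_contra hS
    exact Equiv.extendSubtype_not_mem (Finset.equivOfCardEq h) i hS hi
  · exact Equiv.extendSubtype_mem (Finset.equivOfCardEq h) i hi

variable {ε : ℝ}

theorem tremble_mem_unit (hε : ε ∈ Set.Ioo (0 : ℝ) 1) (a : unitInterval) :
    (1 - ε) * (a : ℝ) + ε / 2 ∈ Set.Icc (0 : ℝ) 1 := by
  have h0 := a.2.1
  have h1 := a.2.2
  constructor <;> nlinarith [hε.1, hε.2]

theorem card_mul_le {S : Finset (Fin n)} {b : ℝ} (hb : 0 ≤ b) : S.card • b ≤ n * b := by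
  rw [nsmul_eq_mul]
  refine mul_le_mul_of_nonneg_right ?_ hb
  have := Finset.card_le_univ S
  rw [Fintype.card_fin] at this
  exact_mod_cast this

/-- Without `k` rational supporters a launch requires some other agent to accept mechanically, and
each does so with probability `ε / 2`. -/
theorem launchProb_tremble_le (hε : ε ∈ Set.Ioo (0 : ℝ) 1) {a : Fin n → unitInterval}
    (ha : (Finset.univ.filter fun i => 0 < (a i : ℝ)).card < k) :
    launchProb k (fun i => (1 - ε) * (a i : ℝ) + ε / 2) ≤ n * (ε / 2) := by
  refine (launchProb_le_sum_compl (fun j => tremble_mem_unit hε (a j)) ha).trans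
    ((Finset.sum_le_card_nsmul _ _ (ε / 2) fun j hj => ?_).trans
      (card_mul_le (by linarith [hε.1])))
  simp only [Finset.mem_compl, Finset.mem_filter, Finset.mem_univ, true_and] at hj
  rw [le_antisymm (not_lt.1 hj) (a j).2.1]
  linarith

theorem le_launchProb_tremble (hkn : k ≤ n) (hε : ε ∈ Set.Ioo (0 : ℝ) 1)
    {a : Fin n → unitInterval} (ha : k ≤ (Finset.univ.filter fun i => (a i : ℝ) = 1).card) :
    1 - n * (ε / 2) ≤ launchProb k (fun i => (1 - ε) * (a i : ℝ) + ε / 2) := by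
  refine le_trans (sub_le_sub_left ?_ 1)
    (one_sub_sum_le_launchProb hkn (fun j => tremble_mem_unit hε (a j)) ha)
  refine (Finset.sum_le_card_nsmul _ _ (ε / 2) fun j hj => ?_).trans
    (card_mul_le (by linarith [hε.1]))
  rw [(Finset.mem_filter.1 hj).2]
  linarith

end LaunchProb

/-! ### The launch set and its boundary. -/

section Approval

variable {n k : ℕ} {α β : Fin n → ℝ}

theorem eq_threshold_iff (hα : ∀ i, α i = -1 ∨ α i = 1) (i : Fin n) (μ : ℝ) :
    μ = threshold α β i ↔ α i * μ + β i = 0 := by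
  unfold threshold
  rcases hα i with h | h <;> rw [h] <;> constructor <;> intro h' <;> linarith

theorem mem_approvalRegion_iff (hα : ∀ i, α i = -1 ∨ α i = 1) {μ : ℝ}
    (hμ : μ ∈ Set.Icc (-1 : ℝ) 1) (i : Fin n) :
    μ ∈ approvalRegion α β i ↔ 0 ≤ α i * μ + β i := by
  unfold approvalRegion threshold
  rcases hα i with h | h
  · rw [if_pos h, h]
    constructor
    · intro h'; linarith [h'.2]
    · intro h'; exact ⟨hμ.1, by linarith⟩
  · rw [if_neg (by rw [h]; norm_num), h]
    constructor
    · intro h'; linarith [h'.1]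
    · intro h'; exact ⟨by linarith, hμ.2⟩

theorem approvalCount_eq_card (hα : ∀ i, α i = -1 ∨ α i = 1) {μ : ℝ}
    (hμ : μ ∈ Set.Icc (-1 : ℝ) 1) :
    approvalCount α β μ = (Finset.univ.filter fun i => 0 ≤ α i * μ + β i).card := by
  unfold approvalCount
  rw [← Set.ncard_coe_finset]
  congr 1
  ext i
  simp [mem_approvalRegion_iff hα hμ]

/-- Indifference only adds a smaller number, so the maximum counts an indifferent agent as
approving. -/
theorem sup_approvalNumbers (μ : ℝ) :
    (approvalNumbers α β μ).sup id = approvalCount α β μ := by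
  unfold approvalNumbers
  split_ifs
  · simp
  · rw [Finset.sup_insert, Finset.sup_singleton]
    simp

theorem mem_launchSet_iff (hα : ∀ i, α i = -1 ∨ α i = 1) {μ : ℝ} :
    μ ∈ launchSet k α β ↔ μ ∈ Set.Icc (0 : ℝ) 1 ∧
      k ≤ (Finset.univ.filter fun i => 0 ≤ α i * μ + β i).card := by
  unfold launchSet
  rw [Set.mem_ofPred_eq, sup_approvalNumbers]
  refine and_congr_right fun h => ?_
  rw [approvalCount_eq_card hα ⟨by linarith [h.1], h.2⟩]

/-- A finite union, over coalitions of size at least `k`, of finite intersections of closed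
half-lines, cut with `[0, 1]`. -/
theorem isClosed_launchSet (hα : ∀ i, α i = -1 ∨ α i = 1) : IsClosed (launchSet k α β) := by
  have : launchSet k α β = Set.Icc (0 : ℝ) 1 ∩
      ⋃ A ∈ Finset.univ.filter (fun A : Finset (Fin n) => k ≤ A.card),
        ⋂ i ∈ A, {μ | 0 ≤ α i * μ + β i} := by
    ext μ
    rw [mem_launchSet_iff hα]
    refine and_congr_right fun _ => ?_
    simp only [Finset.mem_filter, Finset.mem_univ, true_and, Set.mem_iUnion, Set.mem_iInter,
      Set.mem_ofPred_eq, exists_prop]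
    constructor
    · intro h
      exact ⟨_, h, fun i hi => (Finset.mem_filter.1 hi).2⟩
    · rintro ⟨A, hA, h⟩
      exact hA.trans (Finset.card_le_card fun i hi => by simpa using h i hi)
  rw [this]
  refine isClosed_Icc.inter (isClosed_biUnion_finset fun A _ => isClosed_biInter fun i _ => ?_)
  exact isClosed_le continuous_const (by fun_prop)

/-- At a point of the launch set that is a limit of points outside it, some agent is indifferent
and exactly `k` agents approve. -/
theorem exists_indifferent_of_boundary (hα : ∀ i, α i = -1 ∨ α i = 1)
    (hβ : ∀ i, β i ∈ Set.Ioo (-1 : ℝ) 1)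
    (hδ : ∀ i j, i ≠ j → threshold α β i ≠ threshold α β j)
    (hδ₀ : ∀ i, α i = -1 → threshold α β i ≠ 0) {z : ℝ} (hz : z ∈ launchSet k α β)
    (hfr : ∃ᶠ y in 𝓝 z, y ∈ Set.Icc (0 : ℝ) 1 ∧ y ∉ launchSet k α β) :
    z ∈ Set.Ioo (0 : ℝ) 1 ∧ ∃ i, α i * z + β i = 0 ∧
      (Finset.univ.filter fun j => 0 ≤ α j * z + β j).card = k := by
  have hz' := (mem_launchSet_iff hα).1 hz
  -- Strict approval survives small changes of the mean, so only an indifferent agent can be lost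
  -- near `z`.
  have hev : ∀ᶠ y in 𝓝 z, ∀ j, 0 < α j * z + β j → 0 < α j * y + β j := by
    rw [eventually_all]
    intro j
    by_cases hj : 0 < α j * z + β j
    · have : ContinuousAt (fun y => α j * y + β j) z := by fun_prop
      filter_upwards [this.eventually (lt_mem_nhds hj)] with y hy _ using hy
    · exact Eventually.of_forall fun y h => absurd h hj
  obtain ⟨y, ⟨hy, hyn⟩, hyj⟩ := (hfr.and_eventually hev).exists
  rw [mem_launchSet_iff hα] at hyn
  have hlt : (Finset.univ.filter fun j => 0 ≤ α j * y + β j).card < k := by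
    by_contra h
    exact hyn ⟨hy, not_lt.1 h⟩
  have key : ∃ i, α i * z + β i = 0 ∧ ¬ 0 ≤ α i * y + β i := by
    by_contra! hcon
    refine absurd (hz'.2.trans (Finset.card_le_card fun j hj => ?_)) (not_le.2 hlt)
    simp only [Finset.mem_filter, Finset.mem_univ, true_and] at hj ⊢
    rcases hj.lt_or_eq with h | h
    · exact (hyj j h).le
    · exact hcon j h.symm
  obtain ⟨i, hi, hiy⟩ := key
  refine ⟨⟨lt_of_le_of_ne hz'.1.1 ?_, ?_⟩, i, hi, le_antisymm ?_ hz'.2⟩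
  -- At `z = 0` the indifferent agent would have `α i = 1`, by the assumption on thresholds, and
  -- would approve at every `y ≥ 0`.
  · intro h0
    rcases hα i with h | h
    · exact hδ₀ i h (((eq_threshold_iff hα i z).2 hi).symm.trans h0.symm)
    · rw [h] at hi hiy
      exact hiy (by linarith [hy.1])
  · have := hβ i
    rcases hα i with h | h <;> rw [h] at hi <;> linarith [this.1, this.2]
  -- Thresholds are distinct, so `i` is the only indifferent agent and at most one approval is lost:
  -- the count at `z` is at most `k`.
  · have hsub : (Finset.univ.filter fun j => 0 ≤ α j * z + β j) ⊆
        insert i (Finset.univ.filter fun j => 0 ≤ α j * y + β j) := by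
      intro j hj
      simp only [Finset.mem_filter, Finset.mem_univ, true_and, Finset.mem_insert] at hj ⊢
      by_cases hji : j = i
      · exact Or.inl hji
      · refine Or.inr (hyj j (lt_of_le_of_ne hj fun h => ?_)).le
        exact hδ j i hji (((eq_threshold_iff hα j z).2 h.symm).symm.trans
          ((eq_threshold_iff hα i z).2 hi))
    have := (Finset.card_le_card hsub).trans (Finset.card_insert_le _ _)
    omega

end Approval

-- The principal's incentives and the law of states and messages given a proposal.

attribute [instance] Assessment.isMarkov_σ Assessment.isMarkov_φ Assessment.isMarkov_ψ

theorem integrable_coe_state {Ω : Type*} [MeasurableSpace Ω] {μ : Measure Ω} [IsFiniteMeasure μ]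
    {f : Ω → State} (hf : Measurable f) : Integrable (fun x => (f x : ℝ)) μ :=
  Integrable.of_bound (measurable_subtype_coe.comp hf).aestronglyMeasurable 1
    (Eventually.of_forall fun x => by rw [Real.norm_eq_abs, abs_le]; exact (f x).2)

theorem integrable_coe_unitInterval {Ω : Type*} [MeasurableSpace Ω] {μ : Measure Ω}
    [IsFiniteMeasure μ] {f : Ω → unitInterval} (hf : Measurable f) :
    Integrable (fun x => (f x : ℝ)) μ :=
  Integrable.of_bound (measurable_subtype_coe.comp hf).aestronglyMeasurable 1
    (Eventually.of_forall fun x => by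
      rw [Real.norm_eq_abs, abs_le]; exact ⟨by linarith [(f x).2.1], (f x).2.2⟩)

namespace Game

variable {n : ℕ} {G : Game n} {M : Type} [MeasurableSpace M] {t : Test} {C : Channel n M}
  {ρ : Assessment t C}

theorem accept_mem_Icc (hε : G.ε ∈ Set.Ioo (0 : ℝ) 1) (i : Fin n) (m : M) :
    G.accept ρ i m ∈ Set.Icc (G.ε / 2) (1 - G.ε / 2) := by
  unfold accept
  have h0 := (ρ.τ i m).2.1
  have h1 := (ρ.τ i m).2.2
  constructor <;> nlinarith [hε.1, hε.2]

theorem accept_mem_Ioo (hε : G.ε ∈ Set.Ioo (0 : ℝ) 1) (i : Fin n) (m : M) :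
    G.accept ρ i m ∈ Set.Ioo (0 : ℝ) 1 := by
  have := accept_mem_Icc (ρ := ρ) hε i m
  exact ⟨by linarith [this.1, hε.1], by linarith [this.2, hε.1]⟩

theorem accept_mem_unit (hε : G.ε ∈ Set.Ioo (0 : ℝ) 1) (i : Fin n) (m : M) :
    G.accept ρ i m ∈ Set.Icc (0 : ℝ) 1 :=
  Set.Ioo_subset_Icc_self (accept_mem_Ioo hε i m)

theorem measurable_accept (i : Fin n) : Measurable (G.accept ρ i) :=
  ((measurable_subtype_coe.comp (ρ.measurable_τ i)).const_mul _).add_const _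

theorem measurable_launch : Measurable (G.launch ρ) :=
  continuous_launchProb.measurable.comp
    (measurable_pi_lambda _ fun i => (measurable_accept i).comp (C.measurable_obs i))

theorem launch_nonneg (hε : G.ε ∈ Set.Ioo (0 : ℝ) 1) (x : C.X) : 0 ≤ G.launch ρ x :=
  launchProb_nonneg fun i => accept_mem_unit hε i _

theorem launch_le_one (hk : G.k ≤ n) (hε : G.ε ∈ Set.Ioo (0 : ℝ) 1) (x : C.X) :
    G.launch ρ x ≤ 1 :=
  launchProb_le_one hk fun i => accept_mem_unit hε i _

theorem integrable_launch (hk : G.k ≤ n) (hε : G.ε ∈ Set.Ioo (0 : ℝ) 1) {μ : Measure C.X}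
    [IsFiniteMeasure μ] : Integrable (G.launch ρ) μ :=
  Integrable.of_bound measurable_launch.aestronglyMeasurable 1
    (Eventually.of_forall fun x => by
      rw [Real.norm_eq_abs, abs_le]
      exact ⟨by linarith [launch_nonneg (ρ := ρ) hε x], launch_le_one hk hε x⟩)

/-- The highest launch probability that the principal can attain after a proposal. -/
noncomputable def maxLaunch (G : Game n) (ρ : Assessment t C) : ℝ := ⨆ x, G.launch ρ x

theorem launch_le_maxLaunch (hk : G.k ≤ n) (hε : G.ε ∈ Set.Ioo (0 : ℝ) 1) (x : C.X) :
    G.launch ρ x ≤ G.maxLaunch ρ :=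
  le_ciSup ⟨1, by rintro _ ⟨x, rfl⟩; exact launch_le_one hk hε x⟩ x

theorem maxLaunch_nonneg (hε : G.ε ∈ Set.Ioo (0 : ℝ) 1) : 0 ≤ G.maxLaunch ρ :=
  Real.iSup_nonneg fun x => launch_nonneg hε x

theorem maxLaunch_le_one (hk : G.k ≤ n) (hε : G.ε ∈ Set.Ioo (0 : ℝ) 1) : G.maxLaunch ρ ≤ 1 :=
  Real.iSup_le (fun x => launch_le_one hk hε x) zero_le_one

/-- At a positive posterior mean her payoff increases strictly in the launch probability, and
optimality is tested against every profile, on or off path. -/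
theorem integral_launch_eq_maxLaunch (hu : ∀ θ, G.u θ = θ) (hk : G.k ≤ n)
    (hε : G.ε ∈ Set.Ioo (0 : ℝ) 1) (hρ : G.IsEquilibrium ρ) {s : t.S}
    (hs : 0 < ∫ θ, (θ : ℝ) ∂(ρ.φ s)) : ∫ x, G.launch ρ x ∂(ρ.σ s) = G.maxLaunch ρ := by
  have hne : Nonempty C.X := nonempty_of_isProbabilityMeasure (ρ.σ s)
  refine le_antisymm ?_ (ciSup_le fun x => ?_)
  · have := integral_mono (μ := ρ.σ s) (integrable_launch (ρ := ρ) hk hε)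
      (integrable_const (G.maxLaunch ρ)) (fun x => launch_le_maxLaunch hk hε x)
    simpa using this
  · have := hρ.message_optimal s x
    unfold proposePayoff at this
    simp only [hu] at this
    exact le_of_mul_le_mul_left (by linarith) hs

/-- Since forgoing yields zero and `c > 0`, a proposal requires a positive posterior mean; the
maximal launch probability follows. -/
theorem proposes_imp (hu : ∀ θ, G.u θ = θ) (hc : 0 < G.c) (hk : G.k ≤ n)
    (hε : G.ε ∈ Set.Ioo (0 : ℝ) 1) (hρ : G.IsEquilibrium ρ) {s : t.S} (hs : 0 < (ρ.γ s : ℝ)) :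
    0 < ∫ θ, (θ : ℝ) ∂(ρ.φ s) ∧ ∫ x, G.launch ρ x ∂(ρ.σ s) = G.maxLaunch ρ ∧
      0 ≤ G.maxLaunch ρ * (∫ θ, (θ : ℝ) ∂(ρ.φ s)) - G.c := by
  have h := hρ.propose_optimal s 0
  have h1 : 0 ≤ G.proposePayoff ρ s := by
    by_contra hneg
    have := mul_neg_of_pos_of_neg hs (not_le.1 hneg)
    simp at h
    linarith
  unfold proposePayoff at h1
  simp only [hu] at h1
  have hL : 0 ≤ ∫ x, G.launch ρ x ∂(ρ.σ s) := integral_nonneg fun x => launch_nonneg hε x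
  have hpos : 0 < ∫ θ, (θ : ℝ) ∂(ρ.φ s) := by
    by_contra hneg
    have := mul_nonpos_of_nonpos_of_nonneg (not_lt.1 hneg) hL
    linarith
  have hV := integral_launch_eq_maxLaunch hu hk hε hρ hpos
  exact ⟨hpos, hV, by rw [hV] at h1; linarith⟩

theorem forgoes_imp (hu : ∀ θ, G.u θ = θ) (hc : 0 < G.c) (hk : G.k ≤ n)
    (hε : G.ε ∈ Set.Ioo (0 : ℝ) 1) (hρ : G.IsEquilibrium ρ) {s : t.S} (hs : (ρ.γ s : ℝ) < 1) :
    G.maxLaunch ρ * (∫ θ, (θ : ℝ) ∂(ρ.φ s)) - G.c ≤ 0 := by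
  by_cases hpos : 0 < ∫ θ, (θ : ℝ) ∂(ρ.φ s)
  · have hV := integral_launch_eq_maxLaunch hu hk hε hρ hpos
    have h := hρ.propose_optimal s 1
    unfold proposePayoff at h
    simp only [hu, hV] at h
    by_contra hneg
    have := not_le.1 hneg
    simp only [Set.Icc.coe_one, one_mul] at h
    nlinarith
  · have := mul_nonpos_of_nonneg_of_nonpos (maxLaunch_nonneg (ρ := ρ) hε) (not_lt.1 hpos)
    linarith

/-- The law of the signals after which the project is proposed. -/
noncomputable def proposalSignalLaw (G : Game n) (ρ : Assessment t C) : Measure t.S :=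
  (G.F.bind t.π).withDensity fun s => ENNReal.ofReal (ρ.γ s)

theorem proposalSignalLaw_le : G.proposalSignalLaw ρ ≤ G.F.bind t.π := by
  conv_rhs => rw [← withDensity_one (μ := G.F.bind t.π)]
  exact withDensity_mono (Eventually.of_forall fun s => ENNReal.ofReal_le_one.2 (ρ.γ s).2.2)

theorem lintegral_proposalLaw {f : State × C.X → ENNReal} (hf : Measurable f) :
    ∫⁻ p, f p ∂(G.proposalLaw ρ) = ∫⁻ q, ENNReal.ofReal (ρ.γ q.2) *
      ∫⁻ x, f (q.1, x) ∂(ρ.σ q.2) ∂(G.F ⊗ₘ t.π) := by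
  have hγ : Measurable fun q : State × t.S => ENNReal.ofReal (ρ.γ q.2) :=
    ENNReal.measurable_ofReal.comp
      (measurable_subtype_coe.comp (ρ.measurable_γ.comp measurable_snd))
  have hm : Measurable fun q : (State × t.S) × C.X => (q.1.1, q.2) := by fun_prop
  have hg : Measurable fun q : State × t.S => ∫⁻ x, f (q.1, x) ∂(ρ.σ q.2) := by
    have : Measurable fun q : State × t.S => ∫⁻ x, f (q.1, x) ∂(ρ.σ.prodMkLeft State q) :=
      Measurable.lintegral_kernel_prod_right' (f := fun p : (State × t.S) × C.X => f (p.1.1, p.2))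
        (hf.comp hm)
    simpa using this
  unfold proposalLaw
  rw [lintegral_map hf hm, Measure.lintegral_compProd
    (f := fun q : (State × t.S) × C.X => f (q.1.1, q.2)) (hf.comp hm)]
  simp only [Kernel.prodMkLeft_apply]
  rw [lintegral_withDensity_eq_lintegral_mul _ hγ hg]
  rfl

section Laws

variable [IsProbabilityMeasure G.F]

theorem lintegral_proposalLaw_fst {f : State → ENNReal} (hf : Measurable f) :
    ∫⁻ p, f p.1 ∂(G.proposalLaw ρ) =
      ∫⁻ θ, (∫⁻ s, ENNReal.ofReal (ρ.γ s) ∂(t.π θ)) * f θ ∂G.F := by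
  have hγ : Measurable fun s : t.S => ENNReal.ofReal (ρ.γ s) :=
    ENNReal.measurable_ofReal.comp (measurable_subtype_coe.comp ρ.measurable_γ)
  rw [lintegral_proposalLaw (f := fun p => f p.1) (hf.comp measurable_fst)]
  simp only [lintegral_const, measure_univ, mul_one]
  rw [Measure.lintegral_compProd (f := fun q : State × t.S => ENNReal.ofReal (ρ.γ q.2) * f q.1)
    ((hγ.comp measurable_snd).mul (hf.comp measurable_fst))]
  exact lintegral_congr fun θ => by exact lintegral_mul_const (f θ) hγ

instance : IsFiniteMeasure (G.proposalLaw ρ) := by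
  constructor
  rw [← lintegral_one, lintegral_proposalLaw measurable_const]
  simp only [lintegral_const, measure_univ, mul_one]
  calc ∫⁻ q, ENNReal.ofReal (ρ.γ q.2) ∂(G.F ⊗ₘ t.π) ≤ ∫⁻ q, 1 ∂(G.F ⊗ₘ t.π) :=
        lintegral_mono fun q => ENNReal.ofReal_le_one.2 (ρ.γ q.2).2.2
    _ < ⊤ := by simp

instance : IsFiniteMeasure (G.proposalSignalLaw ρ) :=
  isFiniteMeasure_of_le _ proposalSignalLaw_le

/-- Bayes' rule reverses the order of state and signal: given the signal, the state and the message
profile are independent. Integrals can thus be computed signal by signal, where the incentive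
constraints live. -/
theorem proposalLaw_eq_snd (hρ : G.IsEquilibrium ρ) :
    G.proposalLaw ρ = (G.proposalSignalLaw ρ ⊗ₘ (ρ.φ ×ₖ ρ.σ)).snd := by
  have hγ : Measurable fun s : t.S => ENNReal.ofReal (ρ.γ s) :=
    ENNReal.measurable_ofReal.comp (measurable_subtype_coe.comp ρ.measurable_γ)
  refine Measure.ext_of_lintegral _ fun f hf => ?_
  have hg : Measurable fun q : t.S × State => ∫⁻ x, f (q.2, x) ∂(ρ.σ q.1) := by
    have : Measurable fun q : t.S × State => ∫⁻ x, f (q.2, x) ∂(ρ.σ.prodMkRight State q) :=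
      Measurable.lintegral_kernel_prod_right' (f := fun p : (t.S × State) × C.X => f (p.1.2, p.2))
        (hf.comp (by fun_prop))
    simpa using this
  have hg' : Measurable fun q : t.S × State =>
      ENNReal.ofReal (ρ.γ q.1) * ∫⁻ x, f (q.2, x) ∂(ρ.σ q.1) := (hγ.comp measurable_fst).mul hg
  have h1 : ∫⁻ p, f p ∂(G.proposalLaw ρ) = ∫⁻ q, ENNReal.ofReal (ρ.γ q.1) *
      ∫⁻ x, f (q.2, x) ∂(ρ.σ q.1) ∂((G.F ⊗ₘ t.π).map Prod.swap) := by
    rw [lintegral_proposalLaw hf, lintegral_map hg' measurable_swap]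
    rfl
  rw [h1, hρ.principal_bayes, Measure.lintegral_compProd hg', Measure.snd,
    lintegral_map hf measurable_snd, Measure.lintegral_compProd
      (f := fun q : t.S × State × C.X => f q.2) (hf.comp measurable_snd)]
  unfold proposalSignalLaw
  have hK : Measurable fun s => ∫⁻ p, f p ∂((ρ.φ ×ₖ ρ.σ) s) := hf.lintegral_kernel
  rw [lintegral_withDensity_eq_lintegral_mul _ hγ hK]
  refine lintegral_congr fun s => ?_
  refine (lintegral_const_mul (ENNReal.ofReal (ρ.γ s)) (hg.comp measurable_prodMk_left)).trans ?_
  rw [Pi.mul_apply, Kernel.prod_apply, lintegral_prod _ hf.aemeasurable]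
  rfl

theorem prior_eq_snd (hρ : G.IsEquilibrium ρ) : G.F = ((G.F.bind t.π) ⊗ₘ ρ.φ).snd := by
  rw [← hρ.principal_bayes, Measure.snd, Measure.map_map measurable_snd measurable_swap]
  exact (Measure.fst_compProd (μ := G.F) (κ := t.π)).symm

end Laws

end Game

/-! ### Ex ante consequences of the principal's incentives. -/

namespace Game

variable {n : ℕ} {G : Game n} {M : Type} [MeasurableSpace M] {t : Test} {C : Channel n M}
  {ρ : Assessment t C}

theorem ae_proposes : ∀ᵐ s ∂(G.proposalSignalLaw ρ), 0 < (ρ.γ s : ℝ) := by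
  have hγ : Measurable fun s : t.S => ENNReal.ofReal (ρ.γ s) :=
    ENNReal.measurable_ofReal.comp (measurable_subtype_coe.comp ρ.measurable_γ)
  unfold proposalSignalLaw
  rw [ae_withDensity_iff hγ]
  refine Eventually.of_forall fun s hs => ?_
  by_contra h
  exact hs (ENNReal.ofReal_eq_zero.2 (not_lt.1 h))

theorem lintegral_propose {ω : Outcome} (hω : G.Induces ρ ω) (θ : State) :
    ∫⁻ s, ENNReal.ofReal (ρ.γ s) ∂(t.π θ) = ENNReal.ofReal (ω.proposed θ) := by
  rw [(hω θ).1, ofReal_integral_eq_lintegral_ofReal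
    (integrable_coe_unitInterval ρ.measurable_γ) (Eventually.of_forall fun s => (ρ.γ s).2.1)]

theorem measurable_proposed {ω : Outcome} (hω : G.Induces ρ ω) :
    Measurable fun θ => (ω.proposed θ : ℝ) := by
  have : (fun θ => (ω.proposed θ : ℝ)) =
      fun θ => (∫⁻ s, ENNReal.ofReal (ρ.γ s) ∂(t.π θ)).toReal := by
    ext θ
    rw [lintegral_propose hω, ENNReal.toReal_ofReal (ω.proposed θ).2.1]
  rw [this]
  exact (Measurable.lintegral_kernel (ENNReal.measurable_ofReal.comp
    (measurable_subtype_coe.comp ρ.measurable_γ))).ennreal_toReal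

variable [IsProbabilityMeasure G.F]

theorem integral_proposalLaw (hρ : G.IsEquilibrium ρ) {g : State × C.X → ℝ} (hg : Measurable g)
    {b : ℝ} (hb : ∀ p, |g p| ≤ b) :
    ∫ p, g p ∂(G.proposalLaw ρ) =
      ∫ s, ∫ p, g p ∂((ρ.φ s).prod (ρ.σ s)) ∂(G.proposalSignalLaw ρ) := by
  rw [proposalLaw_eq_snd hρ, Measure.snd,
    integral_map measurable_snd.aemeasurable hg.aestronglyMeasurable,
    Measure.integral_compProd (f := fun q : t.S × State × C.X => g q.2)
      (Integrable.of_bound (hg.comp measurable_snd).aestronglyMeasurable b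
      (Eventually.of_forall fun p => hb p.2))]
  simp only [Kernel.prod_apply]

/-- After each proposed signal the nonnegative shortfall from the maximum has mean zero. -/
theorem ae_launch_eq (hu : ∀ θ, G.u θ = θ) (hc : 0 < G.c) (hk : G.k ≤ n)
    (hε : G.ε ∈ Set.Ioo (0 : ℝ) 1) (hρ : G.IsEquilibrium ρ) :
    ∀ᵐ p ∂(G.proposalLaw ρ), G.launch ρ p.2 = G.maxLaunch ρ := by
  have hms : MeasurableSet {x | G.launch ρ x = G.maxLaunch ρ} :=
    measurableSet_eq_fun measurable_launch measurable_const
  rw [proposalLaw_eq_snd hρ, Measure.snd,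
    ae_map_iff (p := fun q : State × C.X => G.launch ρ q.2 = G.maxLaunch ρ)
      measurable_snd.aemeasurable (hms.preimage measurable_snd)]
  refine Measure.ae_compProd_of_ae_ae (hms.preimage (measurable_snd.comp measurable_snd)) ?_
  filter_upwards [ae_proposes (ρ := ρ)] with s hs
  have hL := (proposes_imp hu hc hk hε hρ hs).2.1
  have hx : ∀ᵐ x ∂(ρ.σ s), G.launch ρ x = G.maxLaunch ρ := by
    have hi := integrable_launch (ρ := ρ) (μ := ρ.σ s) hk hε
    have h0 : ∫ x, (G.maxLaunch ρ - G.launch ρ x) ∂(ρ.σ s) = 0 := by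
      rw [integral_sub (integrable_const _) hi, hL]
      simp
    rw [integral_eq_zero_iff_of_nonneg (fun x => sub_nonneg.2 (launch_le_maxLaunch hk hε x))
      ((integrable_const _).sub hi)] at h0
    filter_upwards [h0] with x hx
    exact (sub_eq_zero.1 hx).symm
  rw [Kernel.prod_apply]
  exact Measure.quasiMeasurePreserving_snd.ae hx

/-- Every proposed signal has a positive mean, and messages only mix such signals. This places
posterior means after messages in `[0, 1]`, where the launch set lives. -/
theorem setIntegral_proposalLaw_nonneg (hu : ∀ θ, G.u θ = θ) (hc : 0 < G.c) (hk : G.k ≤ n)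
    (hε : G.ε ∈ Set.Ioo (0 : ℝ) 1) (hρ : G.IsEquilibrium ρ) {B : Set C.X}
    (hB : MeasurableSet B) : 0 ≤ ∫ p in Prod.snd ⁻¹' B, (p.1 : ℝ) ∂(G.proposalLaw ρ) := by
  have hm : Measurable fun p : State × C.X => (p.1 : ℝ) * B.indicator (fun _ => (1 : ℝ)) p.2 :=
    (measurable_subtype_coe.comp measurable_fst).mul
      ((measurable_const.indicator hB).comp measurable_snd)
  have h1 : ∫ p in Prod.snd ⁻¹' B, (p.1 : ℝ) ∂(G.proposalLaw ρ) =
      ∫ p, (p.1 : ℝ) * B.indicator (fun _ => (1 : ℝ)) p.2 ∂(G.proposalLaw ρ) := by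
    rw [← integral_indicator (hB.preimage measurable_snd)]
    refine integral_congr_ae (Eventually.of_forall fun p => ?_)
    by_cases hp : p.2 ∈ B <;> simp [hp]
  rw [h1, integral_proposalLaw hρ hm (b := 1) fun p => ?_]
  · refine integral_nonneg_of_ae ?_
    filter_upwards [ae_proposes (ρ := ρ)] with s hs
    have := integral_prod_mul (μ := ρ.φ s) (ν := ρ.σ s) (fun θ : State => (θ : ℝ))
      (B.indicator fun _ => (1 : ℝ))
    rw [Pi.zero_apply, this]
    exact mul_nonneg (proposes_imp hu hc hk hε hρ hs).1.le
      (integral_nonneg fun x => Set.indicator_nonneg (fun _ _ => zero_le_one) x)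
  · have h2 : |(p.1 : ℝ)| ≤ 1 := abs_le.2 p.1.2
    by_cases hp : p.2 ∈ B <;> simp [hp, h2]

theorem integral_proposalLaw_fst {ω : Outcome} (hω : G.Induces ρ ω) {f : State → ℝ}
    (hf : Measurable f) :
    ∫ p, f p.1 ∂(G.proposalLaw ρ) = ∫ θ, f θ * (ω.proposed θ : ℝ) ∂G.F := by
  have hw : Measurable fun θ => ENNReal.ofReal (ω.proposed θ) :=
    ENNReal.measurable_ofReal.comp (measurable_proposed hω)
  have h1 : (G.proposalLaw ρ).map Prod.fst =
      G.F.withDensity fun θ => ENNReal.ofReal (ω.proposed θ) := by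
    refine Measure.ext_of_lintegral _ fun g hg => ?_
    rw [lintegral_map hg measurable_fst, lintegral_proposalLaw_fst hg,
      lintegral_withDensity_eq_lintegral_mul _ hw hg]
    exact lintegral_congr fun θ => by rw [lintegral_propose hω]; rfl
  rw [← integral_map (f := f) measurable_fst.aemeasurable hf.aestronglyMeasurable, h1,
    integral_withDensity_eq_integral_toReal_smul hw
      (Eventually.of_forall fun _ => ENNReal.ofReal_lt_top)]
  refine integral_congr_ae (Eventually.of_forall fun θ => ?_)
  simp only [ENNReal.toReal_ofReal (ω.proposed θ).2.1, smul_eq_mul]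
  ring

theorem integrable_proposed {ω : Outcome} (hω : G.Induces ρ ω) :
    Integrable (fun θ => (ω.proposed θ : ℝ)) G.F :=
  Integrable.of_bound (measurable_proposed hω).aestronglyMeasurable 1
    (Eventually.of_forall fun θ => by
      rw [Real.norm_eq_abs, abs_of_nonneg (ω.proposed θ).2.1]; exact (ω.proposed θ).2.2)

theorem integrable_coe_mul_proposed {ω : Outcome} (hω : G.Induces ρ ω) :
    Integrable (fun θ : State => (θ : ℝ) * (ω.proposed θ : ℝ)) G.F :=
  (integrable_proposed hω).bdd_mul measurable_subtype_coe.aestronglyMeasurable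
    (c := 1) (Eventually.of_forall fun θ => abs_le.2 θ.2)

/-- The conditional launch probability is the constant `maxLaunch` wherever a proposal can occur;
states without proposals contribute nothing. -/
theorem payoff_eq (hu : ∀ θ, G.u θ = θ) (hc : 0 < G.c) (hk : G.k ≤ n)
    (hε : G.ε ∈ Set.Ioo (0 : ℝ) 1) (hρ : G.IsEquilibrium ρ) {ω : Outcome}
    (hω : G.Induces ρ ω) :
    G.payoff ω = G.maxLaunch ρ * (∫ θ, (θ : ℝ) * (ω.proposed θ : ℝ) ∂G.F) -
      G.c * ∫ θ, (ω.proposed θ : ℝ) ∂G.F := by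
  have hl : ∀ θ, (ω.proposed θ : ℝ) * (ω.launched θ : ℝ) =
      G.maxLaunch ρ * (ω.proposed θ : ℝ) := by
    intro θ
    rw [(hω θ).2, (hω θ).1, ← integral_const_mul]
    refine integral_congr_ae (Eventually.of_forall fun s => ?_)
    rcases (ρ.γ s).2.1.lt_or_eq with hs | hs
    · simp only [(proposes_imp hu hc hk hε hρ hs).2.1]; ring
    · simp only [← hs]; ring
  unfold payoff
  rw [← integral_const_mul, ← integral_const_mul, ← integral_sub
    ((integrable_coe_mul_proposed hω).const_mul _) ((integrable_proposed hω).const_mul _)]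
  refine integral_congr_ae (Eventually.of_forall fun θ => ?_)
  simp only [hu]
  linear_combination (θ : ℝ) * hl θ

/-- The aggregate form of the incentive to forgo, obtained by integrating `forgoes_imp` with weight
`1 - γ`. -/
theorem forgone_le (hu : ∀ θ, G.u θ = θ) (hc : 0 < G.c) (hk : G.k ≤ n)
    (hε : G.ε ∈ Set.Ioo (0 : ℝ) 1) (hρ : G.IsEquilibrium ρ) {ω : Outcome}
    (hω : G.Induces ρ ω) :
    G.maxLaunch ρ * (∫ θ, (θ : ℝ) * (1 - (ω.proposed θ : ℝ)) ∂G.F) ≤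
      G.c * ∫ θ, (1 - (ω.proposed θ : ℝ)) ∂G.F := by
  set V := G.maxLaunch ρ with hV
  have hγ : Measurable fun s : t.S => ENNReal.ofReal (ρ.γ s) :=
    ENNReal.measurable_ofReal.comp (measurable_subtype_coe.comp ρ.measurable_γ)
  have hsm : Measurable fun s : t.S => ∫ θ, (V * (θ : ℝ) - G.c) ∂(ρ.φ s) :=
    (StronglyMeasurable.integral_kernel (κ := ρ.φ)
      (f := fun θ : State => V * (θ : ℝ) - G.c)
      ((measurable_subtype_coe.const_mul V).sub_const G.c).stronglyMeasurable).measurable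
  have hb : ∀ θ : State, |V * (θ : ℝ) - G.c| ≤ |V| + G.c := by
    intro θ
    refine (abs_sub _ _).trans (add_le_add ?_ (abs_of_pos hc).le)
    rw [abs_mul]
    exact mul_le_of_le_one_right (abs_nonneg _) (abs_le.2 θ.2)
  have hm : ∀ s, ∫ θ, (V * (θ : ℝ) - G.c) ∂(ρ.φ s) = V * (∫ θ, (θ : ℝ) ∂(ρ.φ s)) - G.c := by
    intro s
    rw [integral_sub ((integrable_coe_state (f := fun θ => θ) measurable_id).const_mul V)
      (integrable_const _),
      integral_const_mul]
    simp
  have h1 : ∫ θ : State, (V * (θ : ℝ) - G.c) ∂G.F =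
      ∫ s, ∫ θ, (V * (θ : ℝ) - G.c) ∂(ρ.φ s) ∂(G.F.bind t.π) := by
    have hmeas : Measurable fun θ : State => V * (θ : ℝ) - G.c :=
      (measurable_subtype_coe.const_mul V).sub_const G.c
    conv_lhs => rw [prior_eq_snd hρ]
    rw [Measure.snd, integral_map measurable_snd.aemeasurable hmeas.aestronglyMeasurable,
      Measure.integral_compProd (f := fun q : t.S × State => V * (q.2 : ℝ) - G.c)
        (Integrable.of_bound
        (hmeas.comp measurable_snd).aestronglyMeasurable (|V| + G.c)
        (Eventually.of_forall fun p => hb p.2))]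
  have h2 : ∫ θ : State, (V * (θ : ℝ) - G.c) * (ω.proposed θ : ℝ) ∂G.F =
      ∫ s, (ρ.γ s : ℝ) * ∫ θ, (V * (θ : ℝ) - G.c) ∂(ρ.φ s) ∂(G.F.bind t.π) := by
    have hmeas : Measurable fun θ : State => V * (θ : ℝ) - G.c :=
      (measurable_subtype_coe.const_mul V).sub_const G.c
    rw [← integral_proposalLaw_fst hω hmeas, integral_proposalLaw hρ
      (g := fun p : State × C.X => V * (p.1 : ℝ) - G.c) (hmeas.comp measurable_fst) (b := |V| + G.c) (fun p => hb p.1)]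
    unfold proposalSignalLaw
    rw [integral_withDensity_eq_integral_toReal_smul hγ
      (Eventually.of_forall fun _ => ENNReal.ofReal_lt_top)]
    refine integral_congr_ae (Eventually.of_forall fun s => ?_)
    simp only [ENNReal.toReal_ofReal (ρ.γ s).2.1, smul_eq_mul]
    congr 1
    have := integral_fun_fst (μ := ρ.φ s) (ν := ρ.σ s) (fun θ : State => V * (θ : ℝ) - G.c)
    simpa using this
  have hi : Integrable (fun s : t.S => ∫ θ, (V * (θ : ℝ) - G.c) ∂(ρ.φ s)) (G.F.bind t.π) :=
    Integrable.of_bound hsm.aestronglyMeasurable (|V| + G.c) (Eventually.of_forall fun s => by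
      have := norm_integral_le_of_norm_le_const (μ := ρ.φ s) (f := fun θ : State => V * (θ : ℝ) - G.c)
        (Eventually.of_forall hb)
      simpa using this)
  have hi' : Integrable (fun s : t.S => (ρ.γ s : ℝ) * ∫ θ, (V * (θ : ℝ) - G.c) ∂(ρ.φ s))
      (G.F.bind t.π) :=
    hi.bdd_mul (measurable_subtype_coe.comp ρ.measurable_γ).aestronglyMeasurable (c := 1)
      (Eventually.of_forall fun s => by
        simp only [Real.norm_eq_abs, abs_of_nonneg (ρ.γ s).2.1, (ρ.γ s).2.2])
  -- The integrand is `1 - γ s` times the interim gain from proposing: the first factor vanishes or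
  -- the second is nonpositive.
  have h3 : ∫ s, ∫ θ, (V * (θ : ℝ) - G.c) ∂(ρ.φ s) ∂(G.F.bind t.π) -
      ∫ s, (ρ.γ s : ℝ) * ∫ θ, (V * (θ : ℝ) - G.c) ∂(ρ.φ s) ∂(G.F.bind t.π) ≤ 0 := by
    rw [← integral_sub hi hi']
    refine integral_nonpos fun s => ?_
    simp only [Pi.zero_apply]
    rw [hm]
    rcases (ρ.γ s).2.2.lt_or_eq with hs | hs
    · nlinarith [forgoes_imp hu hc hk hε hρ hs]
    · rw [hs]; linarith
  rw [← h1, ← h2] at h3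
  have hθ : Integrable (fun θ : State => (θ : ℝ)) G.F := integrable_coe_state measurable_id
  have e1 : ∫ θ, (θ : ℝ) * (1 - (ω.proposed θ : ℝ)) ∂G.F =
      ∫ θ, (θ : ℝ) ∂G.F - ∫ θ, (θ : ℝ) * (ω.proposed θ : ℝ) ∂G.F := by
    rw [← integral_sub hθ (integrable_coe_mul_proposed hω)]
    exact integral_congr_ae (Eventually.of_forall fun θ => by ring)
  have e2 : ∫ θ, (1 - (ω.proposed θ : ℝ)) ∂G.F = 1 - ∫ θ, (ω.proposed θ : ℝ) ∂G.F := by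
    rw [integral_sub (integrable_const _) (integrable_proposed hω)]
    simp
  have e3 : ∫ θ : State, (V * (θ : ℝ) - G.c) ∂G.F = V * ∫ θ, (θ : ℝ) ∂G.F - G.c := by
    rw [integral_sub (hθ.const_mul V) (integrable_const _), integral_const_mul]
    simp
  have e4 : ∫ θ : State, (V * (θ : ℝ) - G.c) * (ω.proposed θ : ℝ) ∂G.F =
      V * ∫ θ, (θ : ℝ) * (ω.proposed θ : ℝ) ∂G.F - G.c * ∫ θ, (ω.proposed θ : ℝ) ∂G.F := by
    rw [← integral_const_mul, ← integral_const_mul, ← integral_sub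
      ((integrable_coe_mul_proposed hω).const_mul _) ((integrable_proposed hω).const_mul _)]
    exact integral_congr_ae (Eventually.of_forall fun θ => by ring)
  rw [e1, e2]
  rw [e3, e4] at h3
  linarith

end Game

/-! ### Agents' votes and the mean of the state given a proposal. -/

namespace Game

variable {n : ℕ} {G : Game n} {M : Type} [MeasurableSpace M] {t : Test} {C : Channel n M}
  {ρ : Assessment t C}

/-- A rational agent who may accept expects a nonnegative payoff from launching, if he is sure of
the other agents' acceptance probabilities. -/
theorem expected_nonneg_of_accepts (hk₁ : 1 ≤ G.k) (hk : G.k ≤ n)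
    (hε : G.ε ∈ Set.Ioo (0 : ℝ) 1) (hρ : G.IsEquilibrium ρ) {i : Fin n} {m : M} (y : Fin n → M)
    (hy : ∀ᵐ p ∂(ρ.ψ i m), ∀ j, G.accept ρ j (C.obs j p.2) = G.accept ρ j (y j))
    (hτ : 0 < (ρ.τ i m : ℝ)) : 0 ≤ ∫ p, G.v i p.1 ∂(ρ.ψ i m) := by
  -- With the others' acceptance probabilities known, the payoff is affine in the own vote; its
  -- slope is the expected payoff times a pivot probability, positive thanks to trembles.
  have hpay : ∀ a : ℝ, G.votePayoff ρ i m a = (∫ p, G.v i p.1 ∂(ρ.ψ i m)) *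
      (launchWithout G.k (fun j => G.accept ρ j (y j)) i +
        a * pivotProb G.k (fun j => G.accept ρ j (y j)) i) := by
    intro a
    unfold votePayoff
    rw [← launchProb_update, ← integral_mul_const]
    refine integral_congr_ae ?_
    filter_upwards [hy] with p hp
    simp only [hp]
  have h := hρ.vote_optimal i m 0
  rw [hpay, hpay] at h
  have hpiv : 0 < pivotProb G.k (fun j => G.accept ρ j (y j)) i :=
    pivotProb_pos hk₁ hk (fun j => accept_mem_Ioo hε j _) i
  have := mul_pos hτ hpiv
  by_contra hneg
  have := mul_neg_of_neg_of_pos (not_le.1 hneg) this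
  simp only [Set.Icc.coe_zero, zero_mul, add_zero] at h
  linarith

theorem le_card_accepting (hε : G.ε ∈ Set.Ioo (0 : ℝ) 1) (y : Fin n → M)
    (hy : n * (G.ε / 2) < launchProb G.k fun j => G.accept ρ j (y j)) :
    G.k ≤ (Finset.univ.filter fun i => 0 < (ρ.τ i (y i) : ℝ)).card := by
  by_contra hlt
  exact absurd (launchProb_tremble_le hε (not_le.1 hlt)) (not_le.2 hy)

section Linear

variable [IsProbabilityMeasure G.F] {α β : Fin n → ℝ}

theorem measurable_affine (a b : ℝ) : Measurable fun θ : State => a * (θ : ℝ) + b :=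
  (measurable_subtype_coe.const_mul a).add_const b

theorem integrable_affine (a b : ℝ) {Ω : Type*} [MeasurableSpace Ω] {μ : Measure Ω}
    [IsFiniteMeasure μ] {f : Ω → State} (hf : Measurable f) :
    Integrable (fun x => a * (f x : ℝ) + b) μ :=
  ((integrable_coe_state hf).const_mul a).add (integrable_const b)

theorem integral_proposalLaw_affine {ω : Outcome} (hω : G.Induces ρ ω) (a b : ℝ) :
    ∫ p, (a * (p.1 : ℝ) + b) ∂(G.proposalLaw ρ) =
      a * (∫ θ, (θ : ℝ) * (ω.proposed θ : ℝ) ∂G.F) + b * ∫ θ, (ω.proposed θ : ℝ) ∂G.F := by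
  rw [integral_proposalLaw_fst (f := fun θ => a * (θ : ℝ) + b) hω (measurable_affine a b),
    ← integral_const_mul, ← integral_const_mul, ← integral_add
    ((integrable_coe_mul_proposed hω).const_mul _) ((integrable_proposed hω).const_mul _)]
  exact integral_congr_ae (Eventually.of_forall fun θ => by ring)

theorem proposalLaw_ne_zero {ω : Outcome} (hω : G.Induces ρ ω)
    (hP : 0 < ∫ θ, (ω.proposed θ : ℝ) ∂G.F) : G.proposalLaw ρ ≠ 0 := by
  intro h
  have := integral_proposalLaw_affine (G := G) (ρ := ρ) hω 0 1
  rw [h, integral_zero_measure] at this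
  linarith

/-- The interim payoff is nonnegative at each proposed signal; integrate over signals. -/
theorem payoff_nonneg (hu : ∀ θ, G.u θ = θ) (hc : 0 < G.c) (hk : G.k ≤ n)
    (hε : G.ε ∈ Set.Ioo (0 : ℝ) 1) (hρ : G.IsEquilibrium ρ) {ω : Outcome}
    (hω : G.Induces ρ ω) : 0 ≤ G.payoff ω := by
  have h1 := integral_proposalLaw_affine (G := G) (ρ := ρ) hω (G.maxLaunch ρ) (-G.c)
  rw [payoff_eq hu hc hk hε hρ hω, sub_eq_add_neg, ← neg_mul, ← h1,
    integral_proposalLaw (g := fun p => G.maxLaunch ρ * (p.1 : ℝ) + -G.c) hρ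
      ((measurable_affine _ _).comp measurable_fst) (b := |G.maxLaunch ρ| + G.c) fun p => ?_]
  · refine integral_nonneg_of_ae ?_
    filter_upwards [ae_proposes (ρ := ρ)] with s hs
    have h2 : ∫ p, (G.maxLaunch ρ * (p.1 : ℝ) + -G.c) ∂((ρ.φ s).prod (ρ.σ s)) =
        G.maxLaunch ρ * (∫ θ, (θ : ℝ) ∂(ρ.φ s)) - G.c := by
      rw [integral_add ((integrable_coe_state measurable_fst).const_mul _) (integrable_const _),
        integral_const_mul, integral_fun_fst (fun θ : State => (θ : ℝ))]
      simp [sub_eq_add_neg]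
    rw [h2]
    exact (proposes_imp hu hc hk hε hρ hs).2.2
  · refine (abs_add_le _ _).trans (add_le_add ?_ (by rw [abs_neg, abs_of_pos hc]))
    rw [abs_mul]
    exact mul_le_of_le_one_right (abs_nonneg _) (abs_le.2 p.1.2)

/-- Under private messaging, if a launch is likely then at least `k` rational agents approve at
the mean of the state conditional on a proposal. -/
theorem le_card_approving_private {ρ : Assessment t (privateChannel n M)}
    (hu : ∀ θ, G.u θ = θ) (hv : ∀ i θ, G.v i θ = α i * θ + β i)
    (hc : 0 < G.c) (hk₁ : 1 ≤ G.k) (hk : G.k ≤ n) (hε : G.ε ∈ Set.Ioo (0 : ℝ) 1)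
    (hρ : G.IsEquilibrium ρ) {ω : Outcome} (hω : G.Induces ρ ω)
    (hP : 0 < ∫ θ, (ω.proposed θ : ℝ) ∂G.F) (hV : n * (G.ε / 2) < G.maxLaunch ρ) :
    G.k ≤ (Finset.univ.filter fun i => 0 ≤ α i *
      ((∫ θ, (θ : ℝ) * (ω.proposed θ : ℝ) ∂G.F) / ∫ θ, (ω.proposed θ : ℝ) ∂G.F) + β i).card := by
  have hae := ae_launch_eq hu hc hk hε hρ
  have : NeZero (G.proposalLaw ρ) := ⟨proposalLaw_ne_zero hω hP⟩
  obtain ⟨p₀, hp₀⟩ := hae.exists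
  set y : Fin n → M := p₀.2 with hy
  -- Private messaging allows one agent's message to be replaced alone. As he is pivotal with
  -- positive probability, a profile attaining the maximal launch probability must maximize each
  -- agent's acceptance separately.
  have hmono : ∀ x y : Fin n → M, G.launch ρ x = G.maxLaunch ρ → ∀ j,
      G.accept ρ j (y j) ≤ G.accept ρ j (x j) := by
    intro x y hx j
    by_contra hlt
    have hle := launch_le_maxLaunch (ρ := ρ) hk hε (Function.update x j (y j))
    have hupd : ∀ z : M, (fun i => G.accept ρ i ((privateChannel n M).obs i
        (Function.update x j z))) =
        Function.update (fun i => G.accept ρ i (x i)) j (G.accept ρ j z) := by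
      intro z
      ext i
      by_cases hij : i = j
      · subst hij; simp [privateChannel]
      · simp [privateChannel, hij]
    have h1 : G.launch ρ x = G.launch ρ (Function.update x j (x j)) := by
      rw [Function.update_eq_self]
    have hpiv : 0 < pivotProb G.k (fun i => G.accept ρ i (x i)) j :=
      pivotProb_pos hk₁ hk (fun i => accept_mem_Ioo hε i _) j
    rw [← hx, h1] at hle
    unfold launch at hle
    rw [hupd, hupd, launchProb_update, launchProb_update] at hle
    nlinarith
  have hacc : ∀ᵐ p ∂(G.proposalLaw ρ), ∀ j, G.accept ρ j ((privateChannel n M).obs j p.2) =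
      G.accept ρ j (y j) := by
    filter_upwards [hae] with p hp j
    exact le_antisymm (hmono y p.2 hp₀ j) (hmono p.2 y hp j)
  refine (le_card_accepting (ρ := ρ) hε y (hV.trans_eq hp₀.symm)).trans
    (Finset.card_le_card fun i hi => ?_)
  simp only [Finset.mem_filter, Finset.mem_univ, true_and] at hi ⊢
  have hobs : Measurable fun p : State × (privateChannel n M).X =>
      ((privateChannel n M).obs i p.2, p) := by
    have := (privateChannel n M).measurable_obs i
    fun_prop
  have hb := hρ.agent_bayes i
  have hms : MeasurableSet {q : M × (State × (privateChannel n M).X) |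
      ∀ j, G.accept ρ j ((privateChannel n M).obs j q.2.2) = G.accept ρ j (y j)} := by
    rw [show {q : M × (State × (privateChannel n M).X) |
      ∀ j, G.accept ρ j ((privateChannel n M).obs j q.2.2) = G.accept ρ j (y j)} =
      ⋂ j, {q | G.accept ρ j ((privateChannel n M).obs j q.2.2) = G.accept ρ j (y j)} by
        ext; simp]
    refine MeasurableSet.iInter fun j => measurableSet_eq_fun ?_ measurable_const
    exact (measurable_accept j).comp (((privateChannel n M).measurable_obs j).comp
      (measurable_snd.comp measurable_snd))
  have hacc2 : ∀ᵐ q ∂((G.proposalLaw ρ).map (fun p => (privateChannel n M).obs i p.2) ⊗ₘ ρ.ψ i),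
      ∀ j, G.accept ρ j ((privateChannel n M).obs j q.2.2) = G.accept ρ j (y j) := by
    rw [← hb, ae_map_iff hobs.aemeasurable hms]
    exact hacc
  have hacc3 : ∀ᵐ m ∂((G.proposalLaw ρ).map (fun p => (privateChannel n M).obs i p.2)),
      G.accept ρ i m = G.accept ρ i (y i) := by
    have hm : Measurable fun p : State × (privateChannel n M).X =>
        (privateChannel n M).obs i p.2 :=
      ((privateChannel n M).measurable_obs i).comp measurable_snd
    rw [ae_map_iff hm.aemeasurable
      (measurableSet_eq_fun (measurable_accept i) measurable_const)]
    filter_upwards [hacc] with p hp using hp i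
  -- An agent who may accept after `y i` accepts equally often after almost every message he gets,
  -- so his expected payoff is nonnegative message by message, and hence on average given a
  -- proposal.
  have hnn : 0 ≤ ∫ p, (α i * (p.1 : ℝ) + β i) ∂(G.proposalLaw ρ) := by
    have hf : Measurable fun q : M × (State × (privateChannel n M).X) =>
      α i * (q.2.1 : ℝ) + β i := (measurable_affine _ _).comp (measurable_fst.comp measurable_snd)
    have := integral_map (μ := G.proposalLaw ρ) hobs.aemeasurable hf.aestronglyMeasurable
    rw [← this, hb, Measure.integral_compProd
      (integrable_affine (f := fun q : M × (State × (privateChannel n M).X) => q.2.1) _ _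
        (measurable_fst.comp measurable_snd))]
    refine integral_nonneg_of_ae ?_
    filter_upwards [Measure.ae_ae_of_ae_compProd hacc2, hacc3] with m hm1 hm2
    have hτ : 0 < (ρ.τ i m : ℝ) := by
      unfold accept at hm2
      have h1 : (1 - G.ε) * (ρ.τ i m : ℝ) = (1 - G.ε) * (ρ.τ i (y i) : ℝ) := by linarith
      rw [mul_left_cancel₀ (by linarith [hε.2]) h1]
      exact hi
    have := expected_nonneg_of_accepts hk₁ hk hε hρ y hm1 hτ
    simp only [hv] at this
    exact this
  rw [integral_proposalLaw_affine hω] at hnn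
  have : α i * ((∫ θ, (θ : ℝ) * (ω.proposed θ : ℝ) ∂G.F) / ∫ θ, (ω.proposed θ : ℝ) ∂G.F) + β i =
      (α i * (∫ θ, (θ : ℝ) * (ω.proposed θ : ℝ) ∂G.F) + β i * ∫ θ, (ω.proposed θ : ℝ) ∂G.F) /
        ∫ θ, (ω.proposed θ : ℝ) ∂G.F := by
    field_simp
  rw [this]
  exact div_nonneg hnn hP.le

/-- Under public messaging, if a launch is likely then the mean of the state conditional on a
proposal and on the message lies in the launch set; if the launch set is convex, so does the mean
conditional on a proposal. -/
theorem mem_launchSet_public {ρ : Assessment t (publicChannel n M)} (hα : ∀ i, α i = -1 ∨ α i = 1)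
    (hΛ : Convex ℝ (launchSet G.k α β))
    (hu : ∀ θ, G.u θ = θ) (hv : ∀ i θ, G.v i θ = α i * θ + β i)
    (hc : 0 < G.c) (hk₁ : 1 ≤ G.k) (hk : G.k ≤ n) (hε : G.ε ∈ Set.Ioo (0 : ℝ) 1)
    (hρ : G.IsEquilibrium ρ) {ω : Outcome} (hω : G.Induces ρ ω)
    (hP : 0 < ∫ θ, (ω.proposed θ : ℝ) ∂G.F) (hV : n * (G.ε / 2) < G.maxLaunch ρ) :
    (∫ θ, (θ : ℝ) * (ω.proposed θ : ℝ) ∂G.F) / ∫ θ, (ω.proposed θ : ℝ) ∂G.F ∈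
      launchSet G.k α β := by
  let i₀ : Fin n := ⟨0, by omega⟩
  set Q : Measure (State × M) := G.proposalLaw ρ with hQ
  have : IsFiniteMeasure Q := inferInstanceAs (IsFiniteMeasure (G.proposalLaw ρ))
  let ψ : Fin n → Kernel M (State × M) := ρ.ψ
  have hψM : ∀ i, IsMarkovKernel (ψ i) := ρ.isMarkov_ψ
  let L : M → ℝ := G.launch ρ
  have hLm : Measurable L := measurable_launch (G := G) (ρ := ρ)
  let K : Fin n → Kernel M State := fun i => Kernel.map (ψ i) Prod.fst
  have hKM : ∀ i, IsMarkovKernel (K i) := fun i => Kernel.IsMarkovKernel.map _ measurable_fst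
  have hK : ∀ i, (Q.map Prod.snd) ⊗ₘ K i = Q.map Prod.swap := by
    intro i
    have hb : Q.map (fun p => (p.2, p)) = (Q.map Prod.snd) ⊗ₘ ψ i := hρ.agent_bayes i
    have h := Measure.compProd_map (μ := Q.map Prod.snd) (κ := ψ i) (f := Prod.fst) measurable_fst
    have hm : Measurable fun p : State × M => (p.2, p) := measurable_snd.prodMk measurable_id
    rw [h, ← hb, Measure.map_map (measurable_id.prodMap measurable_fst) hm]
    rfl
  -- All agents condition the same law on the same message, so their beliefs about the state agree
  -- almost surely.
  have hKeq : ∀ i, ∀ᵐ m ∂(Q.map Prod.snd), K i m = K i₀ m := fun i =>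
    Kernel.ae_eq_of_compProd_eq ((hK i).trans (hK i₀).symm)
  let h : M → ℝ := fun m => ∫ θ, (θ : ℝ) ∂(K i₀ m)
  have hhm : Measurable h := (StronglyMeasurable.integral_kernel (κ := K i₀)
    (f := fun θ : State => (θ : ℝ)) measurable_subtype_coe.stronglyMeasurable).measurable
  have hhb : ∀ m, |h m| ≤ 1 := fun m => by
    have := norm_integral_le_of_norm_le_const (μ := K i₀ m) (f := fun θ : State => (θ : ℝ)) (C := 1)
      (Eventually.of_forall fun θ => abs_le.2 θ.2)
    simpa using this
  have hhi : Integrable h (Q.map Prod.snd) :=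
    Integrable.of_bound hhm.aestronglyMeasurable 1 (Eventually.of_forall hhb)
  have hset : ∀ s : Set M, MeasurableSet s →
      ∫ m in s, h m ∂(Q.map Prod.snd) = ∫ p in Prod.snd ⁻¹' s, (p.1 : ℝ) ∂Q := by
    intro s hs
    have hint : Integrable (fun q : M × State => (q.2 : ℝ)) ((Q.map Prod.snd) ⊗ₘ K i₀) :=
      integrable_coe_state measurable_snd
    have h1 := Measure.setIntegral_compProd hs MeasurableSet.univ hint.integrableOn
    rw [hK i₀, setIntegral_map (f := fun q : M × State => (q.2 : ℝ)) (hs.prod MeasurableSet.univ)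
      (measurable_subtype_coe.comp measurable_snd).aestronglyMeasurable
      measurable_swap.aemeasurable] at h1
    simp only [Measure.restrict_univ] at h1
    rw [← h1]
    congr 2
    ext p
    simp
  have hnn : ∀ᵐ m ∂(Q.map Prod.snd), 0 ≤ h m := by
    refine ae_nonneg_of_forall_setIntegral_nonneg hhi fun s hs _ => ?_
    rw [hset s hs]
    exact setIntegral_proposalLaw_nonneg hu hc hk hε hρ hs
  have hlaunch : ∀ᵐ m ∂(Q.map Prod.snd), L m = G.maxLaunch ρ := by
    rw [ae_map_iff measurable_snd.aemeasurable (measurableSet_eq_fun hLm measurable_const)]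
    exact ae_launch_eq hu hc hk hε hρ
  have hmem : ∀ᵐ m ∂(Q.map Prod.snd), h m ∈ launchSet G.k α β := by
    filter_upwards [hnn, hlaunch, eventually_all.2 hKeq] with m hm0 hmV hmK
    rw [mem_launchSet_iff hα]
    refine ⟨⟨hm0, (abs_le.1 (hhb m)).2⟩, ?_⟩
    refine (le_card_accepting (ρ := ρ) hε (fun _ => m) (hV.trans_eq hmV.symm)).trans
      (Finset.card_le_card fun i hi => ?_)
    simp only [Finset.mem_filter, Finset.mem_univ, true_and] at hi ⊢
    -- Knowing the common message, the agent knows what the others have seen and hence how likely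
    -- they are to accept.
    have hacc : ∀ᵐ p ∂(ψ i m),
        ∀ j, G.accept ρ j p.2 = G.accept ρ j m := by
      have hk : (ψ i m).map Prod.snd = Measure.dirac m :=
        hρ.agent_knows i m
      have hms : MeasurableSet {x : M | ∀ j, G.accept ρ j x = G.accept ρ j m} := by
        rw [show {x : M | ∀ j, G.accept ρ j x = G.accept ρ j m} =
          ⋂ j, {x | G.accept ρ j x = G.accept ρ j m} by ext; simp]
        exact MeasurableSet.iInter fun j =>
          measurableSet_eq_fun (measurable_accept j) measurable_const
      rw [← ae_map_iff (p := fun x : M => ∀ j, G.accept ρ j x = G.accept ρ j m)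
        measurable_snd.aemeasurable hms, hk, ae_dirac_iff hms]
      exact fun _ => rfl
    have hE := expected_nonneg_of_accepts hk₁ hk hε hρ (fun _ => m) hacc hi
    have hfst : ∫ p, (p.1 : ℝ) ∂(ψ i m) = h m := by
      show _ = ∫ θ, (θ : ℝ) ∂(K i₀ m)
      rw [← hmK i]
      simp only [K]
      rw [Kernel.map_apply _ measurable_fst, integral_map measurable_fst.aemeasurable
        measurable_subtype_coe.aestronglyMeasurable]
    simp only [hv] at hE
    have hE' : 0 ≤ ∫ p, (α i * (p.1 : ℝ) + β i) ∂(ψ i m) := hE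
    rw [integral_add ((integrable_coe_state measurable_fst).const_mul _) (integrable_const _),
      integral_const_mul, hfst] at hE'
    simpa using hE'
  have hQ0 : Q ≠ 0 := proposalLaw_ne_zero hω hP
  have : NeZero (Q.map Prod.snd) :=
    ⟨fun h0 => hQ0 ((Measure.map_eq_zero_iff measurable_snd.aemeasurable).1 h0)⟩
  -- The only use of convexity: the mean given a proposal is an average of the means given the
  -- messages.
  have havg := hΛ.average_mem (isClosed_launchSet hα) hmem hhi
  have hT : ∫ m, h m ∂(Q.map Prod.snd) = ∫ θ, (θ : ℝ) * (ω.proposed θ : ℝ) ∂G.F := by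
    have h1 := hset Set.univ MeasurableSet.univ
    rw [Set.preimage_univ, Measure.restrict_univ, Measure.restrict_univ] at h1
    rw [h1]
    exact integral_proposalLaw_fst hω measurable_subtype_coe
  have hP' : (Q.map Prod.snd).real Set.univ = ∫ θ, (ω.proposed θ : ℝ) ∂G.F := by
    have h1 : ∫ p, (1 : ℝ) ∂Q = _ := integral_proposalLaw_fst (f := fun _ => 1) hω measurable_const
    simp only [one_mul] at h1
    rw [← h1, map_measureReal_apply measurable_snd MeasurableSet.univ, Set.preimage_univ]
    simp
  rwa [average_eq, hT, hP', smul_eq_mul, inv_mul_eq_div] at havg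

end Linear

end Game

/-! ### Binary tests and their posteriors. -/

section BinaryTest

/-- The weight of the signal `s` in a binary test that sends `true` with probability `w`. -/
def signalWeight (w : State → unitInterval) (s : Bool) (θ : State) : ℝ :=
  if s then (w θ : ℝ) else 1 - (w θ : ℝ)

theorem signalWeight_mem (w : State → unitInterval) (s : Bool) (θ : State) :
    signalWeight w s θ ∈ Set.Icc (0 : ℝ) 1 := by
  have h0 := (w θ).2.1
  have h1 := (w θ).2.2
  cases s
  · simp only [signalWeight, Bool.false_eq_true, if_false]
    exact ⟨by linarith, by linarith⟩
  · simp only [signalWeight, if_true]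
    exact ⟨h0, h1⟩

theorem measurable_signalWeight {w : State → unitInterval} (hw : Measurable w) (s : Bool) :
    Measurable (signalWeight w s) := by
  cases s
  · exact measurable_const.sub (measurable_subtype_coe.comp hw)
  · exact measurable_subtype_coe.comp hw

theorem measurable_ofReal_signalWeight {w : State → unitInterval} (hw : Measurable w) (s : Bool) :
    Measurable fun θ => ENNReal.ofReal (signalWeight w s θ) :=
  ENNReal.measurable_ofReal.comp (measurable_signalWeight hw s)

theorem integrable_signalWeight {F : Measure State} [IsFiniteMeasure F]
    {w : State → unitInterval} (hw : Measurable w) (s : Bool) : Integrable (signalWeight w s) F :=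
  Integrable.of_bound (measurable_signalWeight hw s).aestronglyMeasurable 1
    (Eventually.of_forall fun θ => by
      rw [Real.norm_eq_abs, abs_of_nonneg (signalWeight_mem w s θ).1]
      exact (signalWeight_mem w s θ).2)

theorem integrable_coe_mul_signalWeight {F : Measure State} [IsFiniteMeasure F]
    {w : State → unitInterval} (hw : Measurable w) (s : Bool) :
    Integrable (fun θ : State => (θ : ℝ) * signalWeight w s θ) F :=
  (integrable_signalWeight hw s).bdd_mul measurable_subtype_coe.aestronglyMeasurable
    (c := 1) (Eventually.of_forall fun θ => abs_le.2 θ.2)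

/-- The kernel of the binary test that sends `true` with probability `w`. -/
noncomputable def binaryKernel (w : State → unitInterval) (hw : Measurable w) :
    Kernel State Bool where
  toFun θ := ENNReal.ofReal (signalWeight w true θ) • Measure.dirac true +
    ENNReal.ofReal (signalWeight w false θ) • Measure.dirac false
  measurable' := by
    refine Measure.measurable_of_measurable_coe _ fun A _ => ?_
    simp only [Measure.coe_add, Measure.coe_smul, Pi.add_apply, Pi.smul_apply, smul_eq_mul]
    exact ((measurable_ofReal_signalWeight hw true).mul_const _).add
      ((measurable_ofReal_signalWeight hw false).mul_const _)

theorem lintegral_binaryKernel {w : State → unitInterval} {hw : Measurable w} (θ : State)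
    (f : Bool → ENNReal) : ∫⁻ s, f s ∂(binaryKernel w hw θ) =
      ENNReal.ofReal (signalWeight w true θ) * f true +
        ENNReal.ofReal (signalWeight w false θ) * f false := by
  show ∫⁻ s, f s ∂(ENNReal.ofReal (signalWeight w true θ) • Measure.dirac true +
    ENNReal.ofReal (signalWeight w false θ) • Measure.dirac false) = _
  rw [lintegral_add_measure, lintegral_smul_measure, lintegral_smul_measure, lintegral_dirac,
    lintegral_dirac]
  rfl

instance {w : State → unitInterval} {hw : Measurable w} : IsMarkovKernel (binaryKernel w hw) := by
  refine ⟨fun θ => ⟨?_⟩⟩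
  rw [← lintegral_one, lintegral_binaryKernel, mul_one, mul_one, ← ENNReal.ofReal_add
    (signalWeight_mem w true θ).1 (signalWeight_mem w false θ).1]
  simp [signalWeight]

theorem integral_binaryKernel {w : State → unitInterval} {hw : Measurable w} (θ : State)
    (f : Bool → ℝ) : ∫ s, f s ∂(binaryKernel w hw θ) =
      signalWeight w true θ * f true + signalWeight w false θ * f false := by
  show ∫ s, f s ∂(ENNReal.ofReal (signalWeight w true θ) • Measure.dirac true +
    ENNReal.ofReal (signalWeight w false θ) • Measure.dirac false) = _
  have hi : ∀ b : Bool, ∀ c : ℝ, Integrable f (ENNReal.ofReal c • Measure.dirac b) := fun b c =>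
    (integrable_dirac (by simp)).smul_measure ENNReal.ofReal_ne_top
  rw [integral_add_measure (hi _ _) (hi _ _), integral_smul_measure, integral_smul_measure,
    integral_dirac, integral_dirac, ENNReal.toReal_ofReal (signalWeight_mem w true θ).1,
    ENNReal.toReal_ofReal (signalWeight_mem w false θ).1]
  rfl

/-- The binary test that sends `true` with probability `w`. -/
noncomputable abbrev binaryTest (w : State → unitInterval) (hw : Measurable w) : Test where
  S := Bool
  π := binaryKernel w hw

/-- The conditional law of the state given the signal `s` of a binary test; the lowest state if
the signal has probability zero. -/
noncomputable def condLaw (F : Measure State) (w : State → unitInterval) (s : Bool) :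
    Measure State :=
  open Classical in
  if ∫⁻ θ, ENNReal.ofReal (signalWeight w s θ) ∂F = 0 then Measure.dirac ⟨-1, by norm_num⟩
  else (∫⁻ θ, ENNReal.ofReal (signalWeight w s θ) ∂F)⁻¹ •
    F.withDensity fun θ => ENNReal.ofReal (signalWeight w s θ)

variable {F : Measure State} [IsProbabilityMeasure F] {w : State → unitInterval}

theorem lintegral_signalWeight_ne_top (s : Bool) :
    ∫⁻ θ, ENNReal.ofReal (signalWeight w s θ) ∂F ≠ ⊤ := by
  refine ne_top_of_le_ne_top ENNReal.one_ne_top ?_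
  calc ∫⁻ θ, ENNReal.ofReal (signalWeight w s θ) ∂F ≤ ∫⁻ _, 1 ∂F :=
        lintegral_mono fun θ => ENNReal.ofReal_le_one.2 (signalWeight_mem w s θ).2
    _ = 1 := by simp

instance (s : Bool) : IsProbabilityMeasure (condLaw F w s) := by
  unfold condLaw
  split_ifs with h
  · infer_instance
  · constructor
    rw [Measure.smul_apply, withDensity_apply _ MeasurableSet.univ, Measure.restrict_univ,
      smul_eq_mul, ENNReal.inv_mul_cancel h (lintegral_signalWeight_ne_top s)]

/-- Bayes' rule. For a signal of probability zero both sides vanish, so the default law does no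
harm. -/
theorem lintegral_mul_condLaw (hw : Measurable w) (s : Bool) {f : State → ENNReal}
    (hf : Measurable f) : ∫⁻ θ, ENNReal.ofReal (signalWeight w s θ) * f θ ∂F =
      (∫⁻ θ, ENNReal.ofReal (signalWeight w s θ) ∂F) * ∫⁻ θ, f θ ∂(condLaw F w s) := by
  have hm := measurable_ofReal_signalWeight hw s
  unfold condLaw
  split_ifs with h
  · rw [h, zero_mul]
    refine (lintegral_eq_zero_iff (hm.mul hf)).2 ?_
    rw [lintegral_eq_zero_iff hm] at h
    filter_upwards [h] with θ hθ
    simp only [Pi.zero_apply] at hθ ⊢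
    rw [Pi.mul_apply, hθ, zero_mul]
  · rw [lintegral_smul_measure, smul_eq_mul, ← mul_assoc,
      ENNReal.mul_inv_cancel h (lintegral_signalWeight_ne_top s), one_mul,
      lintegral_withDensity_eq_lintegral_mul _ hm hf]
    rfl

theorem ofReal_integral_signalWeight (hw : Measurable w) (s : Bool) :
    ∫⁻ θ, ENNReal.ofReal (signalWeight w s θ) ∂F =
      ENNReal.ofReal (∫ θ, signalWeight w s θ ∂F) :=
  (ofReal_integral_eq_lintegral_ofReal (integrable_signalWeight hw s)
    (Eventually.of_forall fun θ => (signalWeight_mem w s θ).1)).symm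

theorem integral_condLaw_of_pos (hw : Measurable w) {s : Bool}
    (hs : 0 < ∫ θ, signalWeight w s θ ∂F) :
    ∫ θ, (θ : ℝ) ∂(condLaw F w s) =
      (∫ θ, (θ : ℝ) * signalWeight w s θ ∂F) / ∫ θ, signalWeight w s θ ∂F := by
  unfold condLaw
  rw [ofReal_integral_signalWeight hw, if_neg (by simpa using hs), integral_smul_measure,
    integral_withDensity_eq_integral_toReal_smul (measurable_ofReal_signalWeight hw s)
      (Eventually.of_forall fun _ => ENNReal.ofReal_lt_top), ENNReal.toReal_inv,
    ENNReal.toReal_ofReal hs.le, smul_eq_mul, inv_mul_eq_div]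
  congr 1
  refine integral_congr_ae (Eventually.of_forall fun θ => ?_)
  simp only [ENNReal.toReal_ofReal (signalWeight_mem w s θ).1, smul_eq_mul]
  ring

/-- The default mean is negative, which makes forgoing optimal after a null signal. -/
theorem integral_condLaw_of_zero (hw : Measurable w) {s : Bool}
    (hs : ∫ θ, signalWeight w s θ ∂F = 0) : ∫ θ, (θ : ℝ) ∂(condLaw F w s) = -1 := by
  unfold condLaw
  rw [ofReal_integral_signalWeight hw, if_pos (by simpa using hs.le),
    integral_dirac' _ _ measurable_subtype_coe.stronglyMeasurable]

end BinaryTest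

/-! ### Equilibria in which the principal reports the signal of a binary test. -/

section Construction

variable {n : ℕ} {w : State → unitInterval} {hw : Measurable w}

theorem lintegral_bind_binaryKernel {F : Measure State} (f : Bool → ENNReal) :
    ∫⁻ s, f s ∂(F.bind (binaryKernel w hw)) =
      (∫⁻ θ, ENNReal.ofReal (signalWeight w true θ) ∂F) * f true +
      (∫⁻ θ, ENNReal.ofReal (signalWeight w false θ) ∂F) * f false := by
  rw [Measure.lintegral_bind (Kernel.aemeasurable _) (Measurable.of_discrete).aemeasurable]
  simp only [lintegral_binaryKernel]
  rw [lintegral_add_left ((measurable_ofReal_signalWeight hw true).mul_const _),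
    lintegral_mul_const _ (measurable_ofReal_signalWeight hw true),
    lintegral_mul_const _ (measurable_ofReal_signalWeight hw false)]

/-- Whether a message is the truthful report of the signal `true`. -/
noncomputable def decodeReport (N : MessageSpace (binaryTest w hw)) (m : N.M) : Bool :=
  open Classical in decide (m = N.incl ({true} : Set Bool))

theorem decodeReport_report (N : MessageSpace (binaryTest w hw)) (s : Bool) :
    decodeReport N (N.incl ({s} : Set Bool)) = s := by
  unfold decodeReport
  cases s
  · rw [decide_eq_false_iff_not]
    intro h
    have : ({false} : Set Bool) = {true} := N.incl_injective h
    simp at this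
  · simp

theorem measurable_decodeReport (N : MessageSpace (binaryTest w hw)) :
    Measurable (decodeReport N) := by
  refine measurable_to_bool ?_
  -- The singleton of one message is measurable as the image of a measurable set under the report
  -- embedding.
  have h := N.measurableEmbedding_report.measurableSet_image.2
    (MeasurableSet.of_discrete (s := ({true} : Set Bool)))
  rw [Set.image_singleton] at h
  convert h using 1
  ext m
  simp [decodeReport]

/-- The kernel from signals to conditional laws of the state. -/
noncomputable def condKernel (F : Measure State) (w : State → unitInterval) :
    Kernel Bool State where
  toFun := condLaw F w
  measurable' := Measurable.of_discrete

variable (F : Measure State) [IsProbabilityMeasure F]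

instance : IsMarkovKernel (condKernel F w) :=
  ⟨fun s => inferInstanceAs (IsProbabilityMeasure (condLaw F w s))⟩

/-- The assessment in which the principal proposes with probability `g s` and reports her signal,
and rational agents treat every message as a report of `true` or of `false`; the belief about the
state is then the conditional law given the signal `b s`. -/
noncomputable def reportAssessment (N : MessageSpace (binaryTest w hw)) (C : Channel n N.M)
    (diag : N.M → C.X) (hdiag : Measurable diag) (g : Bool → unitInterval)
    (a : Bool → Fin n → unitInterval) (b : Bool → Bool) : Assessment (binaryTest w hw) C where
  γ := g
  measurable_γ := Measurable.of_discrete (α := Bool)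
  σ := Kernel.deterministic (fun s : Bool => diag (N.incl ({s} : Set Bool)))
    (Measurable.of_discrete (α := Bool))
  isMarkov_σ := inferInstance
  τ i m := a (decodeReport N m) i
  measurable_τ i := (Measurable.of_discrete (f := fun s : Bool => a s i)).comp
    (measurable_decodeReport N)
  φ := condKernel F w
  isMarkov_φ := inferInstanceAs (IsMarkovKernel (condKernel F w))
  ψ _ := ((condKernel F w).comap (fun m => b (decodeReport N m))
    ((Measurable.of_discrete (f := b)).comp (measurable_decodeReport N))) ×ₖ
      Kernel.deterministic diag hdiag
  isMarkov_ψ _ := inferInstance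

variable {F} {N : MessageSpace (binaryTest w hw)} {C : Channel n N.M}
  {diag : N.M → C.X} {hdiag : Measurable diag} {g : Bool → unitInterval}
  {a : Bool → Fin n → unitInterval} {b : Bool → Bool}

theorem reportAssessment_ψ (i : Fin n) (m : N.M) :
    (reportAssessment F N C diag hdiag g a b).ψ i m =
      (condLaw F w (b (decodeReport N m))).prod (Measure.dirac (diag m)) := by
  simp only [reportAssessment, Kernel.prod_apply, Kernel.deterministic_apply, Kernel.comap_apply]
  rfl

namespace Game

variable {G : Game n} [IsProbabilityMeasure G.F]

theorem lintegral_compProd_binaryKernel {f : State × Bool → ENNReal} (hf : Measurable f) :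
    ∫⁻ q, f q ∂(F ⊗ₘ binaryKernel w hw) =
      (∫⁻ θ, ENNReal.ofReal (signalWeight w true θ) ∂F) * ∫⁻ θ, f (θ, true) ∂(condLaw F w true) +
      (∫⁻ θ, ENNReal.ofReal (signalWeight w false θ) ∂F) *
        ∫⁻ θ, f (θ, false) ∂(condLaw F w false) := by
  rw [Measure.lintegral_compProd hf]
  simp only [lintegral_binaryKernel]
  have hm : ∀ s, Measurable fun θ => f (θ, s) := fun s => hf.comp measurable_prodMk_right
  refine (lintegral_add_left ((measurable_ofReal_signalWeight hw true).mul (hm true)) _).trans ?_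
  exact congrArg₂ (· + ·) (lintegral_mul_condLaw hw true (hm true))
    (lintegral_mul_condLaw hw false (hm false))

theorem reportAssessment_principal_bayes :
    (F ⊗ₘ binaryKernel w hw).map Prod.swap = (F.bind (binaryKernel w hw)) ⊗ₘ condKernel F w := by
  refine Measure.ext_of_lintegral _ fun f hf => ?_
  rw [lintegral_map hf measurable_swap, Measure.lintegral_compProd hf,
    lintegral_bind_binaryKernel, lintegral_compProd_binaryKernel
      (f := fun q => f q.swap) (hf.comp measurable_swap)]
  rfl

theorem lintegral_proposalLaw_reportAssessment {f : State × C.X → ENNReal} (hf : Measurable f) :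
    ∫⁻ p, f p ∂(G.proposalLaw (reportAssessment G.F N C diag hdiag g a b)) =
      (∫⁻ θ, ENNReal.ofReal (signalWeight w true θ) ∂G.F) * (ENNReal.ofReal (g true) *
        ∫⁻ θ, f (θ, diag (N.incl ({true} : Set Bool))) ∂(condLaw G.F w true)) +
      (∫⁻ θ, ENNReal.ofReal (signalWeight w false θ) ∂G.F) * (ENNReal.ofReal (g false) *
        ∫⁻ θ, f (θ, diag (N.incl ({false} : Set Bool))) ∂(condLaw G.F w false)) := by
  have hs : ∀ s : Bool, Measurable fun θ : State => f (θ, diag (N.incl ({s} : Set Bool))) :=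
    fun s => hf.comp measurable_prodMk_right
  have h1 : ∀ q : State × Bool, ∫⁻ x, f (q.1, x)
      ∂((reportAssessment G.F N C diag hdiag g a b).σ q.2) =
      f (q.1, diag (N.incl ({q.2} : Set Bool))) := fun q =>
    lintegral_dirac' _ (hf.comp measurable_prodMk_left)
  rw [lintegral_proposalLaw hf]
  simp only [h1]
  refine (lintegral_compProd_binaryKernel (F := G.F) (f := fun q : State × Bool =>
    ENNReal.ofReal (g q.2) * f (q.1, diag (N.incl ({q.2} : Set Bool)))) ?_).trans ?_
  · refine measurable_from_prod_countable_left fun s => ?_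
    have := (hs s).const_mul (ENNReal.ofReal (g s))
    exact this
  · exact congrArg₂ (· + ·) 
      (congrArg _ (lintegral_const_mul (ENNReal.ofReal (g true)) (hs true)))
      (congrArg _ (lintegral_const_mul (ENNReal.ofReal (g false)) (hs false)))

/-- Beliefs are constrained only after reports of signals that lead to a proposal, so `b` may be
arbitrary at the others. -/
theorem reportAssessment_agent_bayes (hobs : ∀ i m, C.obs i (diag m) = m)
    (hb : ∀ s, (g s : ℝ) ≠ 0 → b s = s) (i : Fin n) :
    (G.proposalLaw (reportAssessment G.F N C diag hdiag g a b)).map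
      (fun p => (C.obs i p.2, p)) =
    ((G.proposalLaw (reportAssessment G.F N C diag hdiag g a b)).map (fun p => C.obs i p.2)) ⊗ₘ
      (reportAssessment G.F N C diag hdiag g a b).ψ i := by
  have hm : Measurable fun p : State × C.X => C.obs i p.2 :=
    (C.measurable_obs i).comp measurable_snd
  have hm' : Measurable fun p : State × C.X => (C.obs i p.2, p) := hm.prodMk measurable_id
  refine Measure.ext_of_lintegral _ fun f hf => ?_
  have hf' : Measurable fun m => ∫⁻ q, f (m, q)
      ∂((reportAssessment G.F N C diag hdiag g a b).ψ i m) :=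
    hf.lintegral_kernel_prod_right'
  rw [lintegral_map hf hm', Measure.lintegral_compProd hf, lintegral_map hf' hm,
    lintegral_proposalLaw_reportAssessment (f := fun p => f (C.obs i p.2, p)) (hf.comp hm'),
    lintegral_proposalLaw_reportAssessment (f := fun p => ∫⁻ q, f (C.obs i p.2, q)
      ∂((reportAssessment G.F N C diag hdiag g a b).ψ i (C.obs i p.2))) (hf'.comp hm)]
  have key : ∀ s : Bool, ENNReal.ofReal (g s) *
      ∫⁻ θ, f (C.obs i (diag (N.incl ({s} : Set Bool))), θ, diag (N.incl ({s} : Set Bool)))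
        ∂(condLaw G.F w s) = ENNReal.ofReal (g s) * ∫⁻ _, ∫⁻ q,
          f (C.obs i (diag (N.incl ({s} : Set Bool))), q)
          ∂((reportAssessment G.F N C diag hdiag g a b).ψ i
            (C.obs i (diag (N.incl ({s} : Set Bool))))) ∂(condLaw G.F w s) := by
    intro s
    by_cases hg : (g s : ℝ) = 0
    · rw [hg]; simp
    · congr 1
      rw [lintegral_const, measure_univ, mul_one]
      simp only [hobs]
      rw [reportAssessment_ψ, decodeReport_report, hb s hg]
      refine Eq.trans ?_ (lintegral_prod _ (hf.comp measurable_prodMk_left).aemeasurable).symm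
      refine lintegral_congr fun θ => ?_
      exact (lintegral_dirac' _
        (hf.comp (measurable_prodMk_left.comp measurable_prodMk_left))).symm
  exact congrArg₂ (· + ·) (congrArg _ (key true)) (congrArg _ (key false))

variable {α β : Fin n → ℝ}

/-- Cheap talk is credible because every profile, including those off path, yields the same launch
probability `V`. What remains are sign conditions: an agent's payoff is affine in his vote with
slope a nonnegative multiple of his expected payoff, and the principal compares `V` times the
posterior mean with the cost. -/
theorem isEquilibrium_reportAssessment (hu : ∀ θ, G.u θ = θ)
    (hv : ∀ i θ, G.v i θ = α i * θ + β i) (hε : G.ε ∈ Set.Ioo (0 : ℝ) 1)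
    (hobs : ∀ i m, C.obs i (diag m) = m) (hb : ∀ s, (g s : ℝ) ≠ 0 → b s = s) {V : ℝ}
    (hV : ∀ x, launchProb G.k
      (fun i => (1 - G.ε) * (a (decodeReport N (C.obs i x)) i : ℝ) + G.ε / 2) = V)
    (hpos : ∀ s i, 0 < α i * (∫ θ, (θ : ℝ) ∂(condLaw G.F w (b s))) + β i → (a s i : ℝ) = 1)
    (hneg : ∀ s i, α i * (∫ θ, (θ : ℝ) ∂(condLaw G.F w (b s))) + β i < 0 → (a s i : ℝ) = 0)
    (hprop : ∀ s, 0 < (∫ θ, (θ : ℝ) ∂(condLaw G.F w s)) * V - G.c → (g s : ℝ) = 1)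
    (hforgo : ∀ s, (∫ θ, (θ : ℝ) ∂(condLaw G.F w s)) * V - G.c < 0 → (g s : ℝ) = 0) :
    G.IsEquilibrium (reportAssessment G.F N C diag hdiag g a b) := by
  set ρ := reportAssessment G.F N C diag hdiag g a b with hρ
  have hL : ∀ x, G.launch ρ x = V := hV
  have hLi : ∀ s, ∫ x, G.launch ρ x ∂(ρ.σ s) = V := by
    intro s
    have : IsProbabilityMeasure (ρ.σ s) := ρ.isMarkov_σ.isProbabilityMeasure s
    simp [hL]
  have hPP : ∀ s, G.proposePayoff ρ s = (∫ θ, (θ : ℝ) ∂(condLaw G.F w s)) * V - G.c := by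
    intro s
    unfold proposePayoff
    rw [hLi]
    simp only [hu]
    rfl
  refine ⟨reportAssessment_principal_bayes (hw := hw), reportAssessment_agent_bayes hobs hb, ?_, ?_, ?_, ?_⟩
  · intro i m
    have hm : Measurable fun p : State × C.X => C.obs i p.2 :=
      (C.measurable_obs i).comp measurable_snd
    rw [reportAssessment_ψ]
    have := Measure.map_map (μ := (condLaw G.F w (b (decodeReport N m))).prod
      (Measure.dirac (diag m))) (C.measurable_obs i) measurable_snd
    rw [Measure.map_snd_prod, measure_univ, one_smul, Measure.map_dirac' (C.measurable_obs i),
      hobs] at this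
    exact this.symm
  · intro s x
    rw [hPP, hL]
    simp only [hu]
    exact le_rfl
  · intro s y
    rw [hPP]
    show (y : ℝ) * _ ≤ (g s : ℝ) * _
    rcases lt_trichotomy ((∫ θ, (θ : ℝ) ∂(condLaw G.F w s)) * V - G.c) 0 with h | h | h
    · rw [hforgo s h, zero_mul]
      exact mul_nonpos_of_nonneg_of_nonpos y.2.1 h.le
    · rw [h, mul_zero, mul_zero]
    · rw [hprop s h]
      exact mul_le_mul_of_nonneg_right y.2.2 h.le
  · intro i m
    have hpay : ∀ y : ℝ, G.votePayoff ρ i m y =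
        (α i * (∫ θ, (θ : ℝ) ∂(condLaw G.F w (b (decodeReport N m)))) + β i) *
        (launchWithout G.k (fun j => G.accept ρ j m) i +
          y * pivotProb G.k (fun j => G.accept ρ j m) i) := by
      intro y
      have hmeas : Measurable fun x : C.X =>
          launchProb G.k (Function.update (fun j => G.accept ρ j (C.obs j x)) i y) := by
        refine continuous_launchProb.measurable.comp (measurable_pi_lambda _ fun j => ?_)
        by_cases hj : j = i
        · subst hj; simp
        · simp only [Function.update_of_ne hj]
          exact (measurable_accept j).comp (C.measurable_obs j)
      unfold votePayoff
      rw [reportAssessment_ψ]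
      have := integral_prod_mul (μ := condLaw G.F w (b (decodeReport N m)))
        (ν := Measure.dirac (diag m)) (fun θ => G.v i θ) (fun x : C.X =>
          launchProb G.k (Function.update (fun j => G.accept ρ j (C.obs j x)) i y))
      rw [this, integral_dirac' _ _ hmeas.stronglyMeasurable, ← launchProb_update]
      simp only [hobs, hv]
      rw [integral_add ((integrable_coe_state (f := fun θ => θ) measurable_id).const_mul _)
        (integrable_const _), integral_const_mul]
      simp
    intro y
    rw [hpay, hpay]
    have hpiv : 0 ≤ pivotProb G.k (fun j => G.accept ρ j m) i :=
      pivotProb_nonneg (fun j => accept_mem_unit hε j m) i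
    have hτ : (ρ.τ i m : ℝ) = (a (decodeReport N m) i : ℝ) := rfl
    rw [hτ]
    rcases lt_trichotomy (α i * (∫ θ, (θ : ℝ) ∂(condLaw G.F w (b (decodeReport N m)))) + β i) 0
      with h | h | h
    · rw [hneg _ _ h]
      exact mul_le_mul_of_nonpos_left (by nlinarith [mul_nonneg y.2.1 hpiv]) h.le
    · rw [h, zero_mul, zero_mul]
    · rw [hpos _ _ h]
      exact mul_le_mul_of_nonneg_left (by nlinarith [mul_nonneg (sub_nonneg.2 y.2.2) hpiv]) h.le

/-- The outcome of a binary test with a constant launch probability `V`. -/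
noncomputable def reportOutcome (w : State → unitInterval) (g : Bool → unitInterval)
    (V : unitInterval) : Outcome where
  proposed θ := ⟨signalWeight w true θ * g true + signalWeight w false θ * g false, by
    have h1 := signalWeight_mem w true θ
    have h2 := signalWeight_mem w false θ
    have h3 : signalWeight w true θ + signalWeight w false θ = 1 := by simp [signalWeight]
    have h4 := mul_le_of_le_one_right h1.1 (g true).2.2
    have h5 := mul_le_of_le_one_right h2.1 (g false).2.2
    exact ⟨add_nonneg (mul_nonneg h1.1 (g true).2.1) (mul_nonneg h2.1 (g false).2.1),
      by linarith⟩⟩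
  launched _ := V

theorem exists_implementable_report (hu : ∀ θ, G.u θ = θ)
    (hv : ∀ i θ, G.v i θ = α i * θ + β i) (hε : G.ε ∈ Set.Ioo (0 : ℝ) 1)
    (diag : N.M → C.X) (hdiag : Measurable diag)
    (hobs : ∀ i m, C.obs i (diag m) = m) (hb : ∀ s, (g s : ℝ) ≠ 0 → b s = s) {V : ℝ}
    (hV01 : V ∈ Set.Icc (0 : ℝ) 1)
    (hV : ∀ x, launchProb G.k
      (fun i => (1 - G.ε) * (a (decodeReport N (C.obs i x)) i : ℝ) + G.ε / 2) = V)
    (hpos : ∀ s i, 0 < α i * (∫ θ, (θ : ℝ) ∂(condLaw G.F w (b s))) + β i → (a s i : ℝ) = 1)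
    (hneg : ∀ s i, α i * (∫ θ, (θ : ℝ) ∂(condLaw G.F w (b s))) + β i < 0 → (a s i : ℝ) = 0)
    (hprop : ∀ s, 0 < (∫ θ, (θ : ℝ) ∂(condLaw G.F w s)) * V - G.c → (g s : ℝ) = 1)
    (hforgo : ∀ s, (∫ θ, (θ : ℝ) ∂(condLaw G.F w s)) * V - G.c < 0 → (g s : ℝ) = 0) :
    ∃ ω ∈ G.implementable (binaryTest w hw) C, G.payoff ω =
      ∫ θ, ((θ : ℝ) * V - G.c) * (signalWeight w true θ * g true +
        signalWeight w false θ * g false) ∂G.F := by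
  refine ⟨reportOutcome w g ⟨V, hV01⟩, ⟨reportAssessment G.F N C diag hdiag g a b,
    isEquilibrium_reportAssessment hu hv hε hobs hb hV hpos hneg hprop hforgo, fun θ => ?_⟩, ?_⟩
  · have hL : ∀ x, G.launch (reportAssessment G.F N C diag hdiag g a b) x = V := hV
    have h1 : ∀ c : ℝ, ∫ s : Bool, (g s : ℝ) * c ∂(binaryKernel w hw θ) =
        (signalWeight w true θ * g true + signalWeight w false θ * g false) * c := fun c => by
      rw [integral_binaryKernel]; ring
    have h2 : ∀ s, IsProbabilityMeasure ((reportAssessment G.F N C diag hdiag g a b).σ s) :=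
      fun s => (reportAssessment G.F N C diag hdiag g a b).isMarkov_σ.isProbabilityMeasure s
    constructor
    · have := h1 1
      simp only [mul_one] at this
      exact this.symm
    · simp only [hL, integral_const, probReal_univ, one_smul]
      exact (h1 V).symm
  · unfold payoff
    simp only [hu]
    rfl

end Game

end Construction

/-! ### Lower bounds on the private and the public value. -/

namespace Game

variable {n : ℕ} {G : Game n} [IsProbabilityMeasure G.F] {α β : Fin n → ℝ}
  {𝓜 : ∀ t : Test, MessageSpace t}

/-- Boundedness makes the values genuine suprema, rather than the default `0` of an unbounded
`sSup`. -/
theorem payoff_le (hu : ∀ θ, G.u θ = θ) (ω : Outcome) : G.payoff ω ≤ 1 + |G.c| := by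
  have h := norm_integral_le_of_norm_le_const (μ := G.F) (C := 1 + |G.c|)
    (f := fun θ => (G.u θ * (ω.launched θ : ℝ) - G.c) * (ω.proposed θ : ℝ))
    (Eventually.of_forall fun θ => by
      rw [hu, norm_mul, Real.norm_eq_abs, Real.norm_eq_abs, abs_of_nonneg (ω.proposed θ).2.1]
      refine (mul_le_of_le_one_right (abs_nonneg _) (ω.proposed θ).2.2).trans ?_
      refine (abs_sub _ _).trans (add_le_add_left ?_ _)
      rw [abs_mul, abs_of_nonneg (ω.launched θ).2.1]
      exact mul_le_one₀ (abs_le.2 θ.2) (ω.launched θ).2.1 (ω.launched θ).2.2)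
  rw [probReal_univ, mul_one] at h
  exact (le_abs_self _).trans h

theorem le_privateValue_of_mem (hu : ∀ θ, G.u θ = θ) {t : Test} {ω : Outcome}
    (hω : ω ∈ G.implementable t (privateChannel n (𝓜 t).M)) :
    G.payoff ω ≤ G.privateValue 𝓜 :=
  le_csSup ⟨1 + |G.c|, by rintro y ⟨t, ω, _, rfl⟩; exact payoff_le hu ω⟩ ⟨t, ω, hω, rfl⟩

theorem le_publicValue_of_mem (hu : ∀ θ, G.u θ = θ) {t : Test} {ω : Outcome}
    (hω : ω ∈ G.implementable t (publicChannel n (𝓜 t).M)) :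
    G.payoff ω ≤ G.publicValue 𝓜 :=
  le_csSup ⟨1 + |G.c|, by rintro y ⟨t, ω, _, rfl⟩; exact payoff_le hu ω⟩ ⟨t, ω, hω, rfl⟩

/-- Proposing with probability `w` and revealing nothing else is optimal under private messaging
if the principal wants to propose, and to forgo the project otherwise. -/
theorem le_privateValue (hu : ∀ θ, G.u θ = θ) (hv : ∀ i θ, G.v i θ = α i * θ + β i)
    (hc : 0 < G.c) (hk : G.k ≤ n) (hε : G.ε ∈ Set.Ioo (0 : ℝ) 1) {w : State → unitInterval}
    (hw : Measurable w) (hP : 0 < ∫ θ, (w θ : ℝ) ∂G.F) {a : Fin n → unitInterval} {V z : ℝ}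
    (hV : launchProb G.k (fun i => (1 - G.ε) * (a i : ℝ) + G.ε / 2) = V)
    (hz : z = (∫ θ, (θ : ℝ) * (w θ : ℝ) ∂G.F) / ∫ θ, (w θ : ℝ) ∂G.F)
    (hpos : ∀ i, 0 < α i * z + β i → (a i : ℝ) = 1)
    (hneg : ∀ i, α i * z + β i < 0 → (a i : ℝ) = 0)
    (hprop : G.c * ∫ θ, (w θ : ℝ) ∂G.F ≤ V * ∫ θ, (θ : ℝ) * (w θ : ℝ) ∂G.F)
    (hforgo : V * ∫ θ, (θ : ℝ) * (1 - (w θ : ℝ)) ∂G.F ≤ G.c * ∫ θ, (1 - (w θ : ℝ)) ∂G.F) :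
    V * (∫ θ, (θ : ℝ) * (w θ : ℝ) ∂G.F) - G.c * ∫ θ, (w θ : ℝ) ∂G.F ≤ G.privateValue 𝓜 := by
  have hV01 : V ∈ Set.Icc (0 : ℝ) 1 := by
    rw [← hV]
    exact ⟨launchProb_nonneg fun i => tremble_mem_unit hε (a i),
      launchProb_le_one hk fun i => tremble_mem_unit hε (a i)⟩
  have hmt : ∫ θ, (θ : ℝ) ∂(condLaw G.F w true) = z := by
    rw [hz]; exact integral_condLaw_of_pos hw hP
  have hmf : (∫ θ, (θ : ℝ) ∂(condLaw G.F w false)) * V - G.c ≤ 0 := by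
    have h0 : 0 ≤ ∫ θ, signalWeight w false θ ∂G.F :=
      integral_nonneg fun θ => (signalWeight_mem w false θ).1
    rcases h0.lt_or_eq with h | h
    · rw [integral_condLaw_of_pos hw h, div_mul_eq_mul_div, sub_nonpos, div_le_iff₀ h, mul_comm]
      exact hforgo
    · rw [integral_condLaw_of_zero hw h.symm]
      linarith [hV01.1]
  -- Votes ignore messages, and every message is read as evidence for `true`; this is consistent
  -- with Bayes' rule because the project is forgone after `false`.
  obtain ⟨ω, hω, hpay⟩ := exists_implementable_report (G := G) (hw := hw)
    (N := 𝓜 (binaryTest w hw)) (C := privateChannel n (𝓜 (binaryTest w hw)).M)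
    (g := fun s => if s then 1 else 0) (a := fun _ => a) (b := fun _ => true) hu hv hε
    (fun m _ => m) (measurable_pi_lambda _ fun _ => measurable_id) (fun _ _ => rfl)
    (fun s => by cases s <;> simp) hV01 (fun _ => hV)
    (fun _ i => by rw [hmt]; exact hpos i) (fun _ i => by rw [hmt]; exact hneg i)
    (fun s => by
      cases s
      · intro h; exact absurd h (not_lt.2 hmf)
      · simp)
    (fun s => by
      cases s
      · simp
      · intro h
        refine absurd h (not_lt.2 ?_)
        rw [hmt, hz, div_mul_eq_mul_div, sub_nonneg, le_div_iff₀ hP]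
        linarith)
  have h1 := le_privateValue_of_mem hu hω
  rw [hpay] at h1
  convert h1 using 1
  have hi₁ : Integrable (fun θ : State => (θ : ℝ) * (w θ : ℝ)) G.F :=
    integrable_coe_mul_signalWeight hw true
  have hi₂ : Integrable (fun θ : State => (w θ : ℝ)) G.F := integrable_signalWeight hw true
  rw [← integral_const_mul, ← integral_const_mul, ← integral_sub (hi₁.const_mul V)
    (hi₂.const_mul G.c)]
  refine integral_congr_ae (Eventually.of_forall fun θ => ?_)
  simp only [if_true, Bool.false_eq_true, if_false, Set.Icc.coe_one, Set.Icc.coe_zero, mul_one,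
    mul_zero, add_zero, signalWeight]
  ring

/-- A public report of the signal of a binary test is credible if both signals lead to the same
launch probability. -/
theorem le_publicValue (hu : ∀ θ, G.u θ = θ) (hv : ∀ i θ, G.v i θ = α i * θ + β i)
    (hk : G.k ≤ n) (hε : G.ε ∈ Set.Ioo (0 : ℝ) 1) {w : State → unitInterval}
    (hw : Measurable w) {a : Bool → Fin n → unitInterval} {V : ℝ} {z : Bool → ℝ}
    (hV : ∀ s, launchProb G.k (fun i => (1 - G.ε) * (a s i : ℝ) + G.ε / 2) = V)
    (hP : ∀ s, 0 < ∫ θ, signalWeight w s θ ∂G.F)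
    (hz : ∀ s, z s = (∫ θ, (θ : ℝ) * signalWeight w s θ ∂G.F) / ∫ θ, signalWeight w s θ ∂G.F)
    (hpos : ∀ s i, 0 < α i * z s + β i → (a s i : ℝ) = 1)
    (hneg : ∀ s i, α i * z s + β i < 0 → (a s i : ℝ) = 0)
    (hprop : ∀ s, G.c ≤ z s * V) :
    V * (∫ θ, (θ : ℝ) ∂G.F) - G.c ≤ G.publicValue 𝓜 := by
  have hV01 : V ∈ Set.Icc (0 : ℝ) 1 := by
    rw [← hV true]
    exact ⟨launchProb_nonneg fun i => tremble_mem_unit hε _,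
      launchProb_le_one hk fun i => tremble_mem_unit hε _⟩
  have hm : ∀ s, ∫ θ, (θ : ℝ) ∂(condLaw G.F w s) = z s := fun s => by
    rw [hz]; exact integral_condLaw_of_pos hw (hP s)
  obtain ⟨ω, hω, hpay⟩ := exists_implementable_report (G := G) (hw := hw)
    (N := 𝓜 (binaryTest w hw)) (C := publicChannel n (𝓜 (binaryTest w hw)).M)
    (g := fun _ => 1) (a := a) (b := fun s => s) hu hv hε
    (fun m => m) measurable_id (fun _ _ => rfl) (fun s _ => rfl) hV01
    (fun x => hV (decodeReport (𝓜 (binaryTest w hw)) x))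
    (fun s i h => hpos s i (by rwa [hm] at h)) (fun s i h => hneg s i (by rwa [hm] at h))
    (fun s _ => rfl)
    (fun s h => by
      rw [hm] at h
      linarith [hprop s])
  have h1 := le_publicValue_of_mem hu hω
  rw [hpay] at h1
  convert h1 using 1
  have h2 : ∫ θ : State, ((θ : ℝ) * V - G.c) ∂G.F = V * (∫ θ, (θ : ℝ) ∂G.F) - G.c := by
    rw [integral_sub ((integrable_coe_state (f := fun θ => θ) measurable_id).mul_const _)
      (integrable_const _), integral_mul_const]
    simp [mul_comm]
  rw [← h2]
  refine integral_congr_ae (Eventually.of_forall fun θ => ?_)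
  simp [signalWeight]

end Game

/-- The vote at the posterior mean `μ`, with approval in case of indifference. -/
noncomputable def approve {n : ℕ} (α β : Fin n → ℝ) (μ : ℝ) (i : Fin n) : unitInterval :=
  open Classical in if 0 ≤ α i * μ + β i then 1 else 0

theorem approve_of_nonneg {n : ℕ} {α β : Fin n → ℝ} {μ : ℝ} {i : Fin n}
    (h : 0 ≤ α i * μ + β i) : (approve α β μ i : ℝ) = 1 := by
  rw [approve, if_pos h, Set.Icc.coe_one]

theorem approve_of_neg {n : ℕ} {α β : Fin n → ℝ} {μ : ℝ} {i : Fin n}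
    (h : α i * μ + β i < 0) : (approve α β μ i : ℝ) = 0 := by
  rw [approve, if_neg (not_le.2 h), Set.Icc.coe_zero]

theorem le_launchProb_approve {n k : ℕ} {α β : Fin n → ℝ} {μ ε : ℝ} (hk : k ≤ n)
    (hε : ε ∈ Set.Ioo (0 : ℝ) 1)
    (h : k ≤ (Finset.univ.filter fun i => 0 ≤ α i * μ + β i).card) :
    1 - n * (ε / 2) ≤ launchProb k (fun i => (1 - ε) * (approve α β μ i : ℝ) + ε / 2) :=
  le_launchProb_tremble hk hε (h.trans (Finset.card_le_card fun i hi => by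
    simp only [Finset.mem_filter, Finset.mem_univ, true_and] at hi ⊢
    exact approve_of_nonneg hi))

/-- An indifferent agent who is decisive can bring about every launch probability between the
extremes. -/
theorem exists_mixed_vote {n k : ℕ} {α β : Fin n → ℝ} {μ ε V : ℝ} (hk : k ≤ n)
    (hε : ε ∈ Set.Ioo (0 : ℝ) 1) {i : Fin n} (hi : α i * μ + β i = 0)
    (hcard : (Finset.univ.filter fun j => 0 ≤ α j * μ + β j).card = k)
    (hV₀ : n * (ε / 2) ≤ V) (hV₁ : V ≤ 1 - n * (ε / 2)) :
    ∃ a : Fin n → unitInterval, launchProb k (fun j => (1 - ε) * (a j : ℝ) + ε / 2) = V ∧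
      (∀ j, 0 < α j * μ + β j → (a j : ℝ) = 1) ∧ ∀ j, α j * μ + β j < 0 → (a j : ℝ) = 0 := by
  have hcont : Continuous fun t : unitInterval => launchProb k
      (fun j => (1 - ε) * (Function.update (approve α β μ) i t j : ℝ) + ε / 2) := by
    refine continuous_launchProb.comp (continuous_pi fun j => ?_)
    have : Continuous fun t : unitInterval => Function.update (approve α β μ) i t j := by
      by_cases hj : j = i
      · subst hj; simpa using continuous_id'
      · simpa only [Function.update_of_ne hj] using continuous_const
    exact ((continuous_subtype_val.comp this).const_mul _).add_const _
  have h0 : (Finset.univ.filter fun j =>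
      0 < (Function.update (approve α β μ) i 0 j : ℝ)).card < k := by
    rw [← hcard]
    refine Finset.card_lt_card ⟨fun j hj => ?_, fun hsub => ?_⟩
    · simp only [Finset.mem_filter, Finset.mem_univ, true_and] at hj ⊢
      by_contra hneg
      have hji : j ≠ i := by rintro rfl; exact hneg hi.ge
      rw [Function.update_of_ne hji, approve_of_neg (not_le.1 hneg)] at hj
      exact lt_irrefl _ hj
    · have := hsub (show i ∈ Finset.univ.filter fun j => 0 ≤ α j * μ + β j by simp [hi])
      simp at this
  have h1 : k ≤ (Finset.univ.filter fun j =>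
      (Function.update (approve α β μ) i 1 j : ℝ) = 1).card := by
    rw [← hcard]
    refine Finset.card_le_card fun j hj => ?_
    simp only [Finset.mem_filter, Finset.mem_univ, true_and] at hj ⊢
    by_cases hji : j = i
    · subst hji; simp
    · rw [Function.update_of_ne hji, approve_of_nonneg hj]
  -- Intermediate values: if agent `i` rejects, fewer than `k` rational agents accept; if he
  -- accepts, `k` do.
  obtain ⟨t, ht⟩ := mem_range_of_exists_le_of_exists_ge (c := V) hcont
    ⟨0, (launchProb_tremble_le hε h0).trans hV₀⟩ ⟨1, hV₁.trans (le_launchProb_tremble hk hε h1)⟩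
  refine ⟨_, ht, fun j hj => ?_, fun j hj => ?_⟩
  · have hji : j ≠ i := by rintro rfl; exact hj.ne' hi
    rw [Function.update_of_ne hji, approve_of_nonneg hj.le]
  · have hji : j ≠ i := by rintro rfl; exact hj.ne hi
    rw [Function.update_of_ne hji, approve_of_neg hj]

/-- On the segment from `(T, P)` to `(T + T₀, P + P₀)`, the ratio leaves the closed set `Λ`
for the last time. -/
theorem exists_last_exit {Λ : Set ℝ} (hΛ : IsClosed Λ) {T P T₀ P₀ : ℝ} (hP : 0 < P)
    (hP₀ : 0 ≤ P₀) (h0 : T / P ∈ Λ) (h1 : (T + T₀) / (P + P₀) ∉ Λ) :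
    ∃ l ∈ Set.Ico (0 : ℝ) 1, (T + l * T₀) / (P + l * P₀) ∈ Λ ∧
      ∃ᶠ y in 𝓝 ((T + l * T₀) / (P + l * P₀)), y ∉ Λ ∧
        ∃ r ∈ Set.Icc (0 : ℝ) 1, y = (T + r * T₀) / (P + r * P₀) := by
  have hpos : ∀ r : ℝ, 0 ≤ r → 0 < P + r * P₀ := fun r hr =>
    add_pos_of_pos_of_nonneg hP (mul_nonneg hr hP₀)
  have hcont : ContinuousOn (fun r => (T + r * T₀) / (P + r * P₀)) (Set.Icc (0 : ℝ) 1) :=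
    ContinuousOn.div (by fun_prop) (by fun_prop) fun r hr => (hpos r hr.1).ne'
  have hcl : IsClosed (Set.Icc (0 : ℝ) 1 ∩ (fun r => (T + r * T₀) / (P + r * P₀)) ⁻¹' Λ) :=
    hcont.preimage_isClosed_of_isClosed isClosed_Icc hΛ
  have hcomp := isCompact_Icc.of_isClosed_subset hcl Set.inter_subset_left
  -- The last parameter with ratio in `Λ` exists by compactness; immediately to its right the ratio
  -- is outside `Λ`.
  obtain ⟨l, ⟨hl, hlΛ⟩, hmax⟩ := hcomp.exists_isGreatest
    ⟨0, ⟨le_rfl, zero_le_one⟩, by simpa using h0⟩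
  have hl1 : l < 1 := lt_of_le_of_ne hl.2 fun h => h1 (by
    rw [h] at hlΛ
    simpa using hlΛ)
  refine ⟨l, ⟨hl.1, hl1⟩, hlΛ, ?_⟩
  have ht : Tendsto (fun r => (T + r * T₀) / (P + r * P₀)) (𝓝[>] l)
      (𝓝 ((T + l * T₀) / (P + l * P₀))) := by
    have hc : ContinuousAt (fun r => (T + r * T₀) / (P + r * P₀)) l :=
      ContinuousAt.div (by fun_prop) (by fun_prop) (hpos l hl.1).ne'
    exact hc.tendsto.mono_left nhdsWithin_le_nhds
  refine ht.frequently (Eventually.frequently ?_)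
  filter_upwards [Ioo_mem_nhdsGT hl1] with r hr
  have hr' : r ∈ Set.Icc (0 : ℝ) 1 := ⟨hl.1.trans hr.1.le, hr.2.le⟩
  exact ⟨fun hin => absurd (hmax ⟨hr', hin⟩) (not_le.2 hr.1), r, hr', rfl⟩

/-! ### The upper bound on the public advantage for a convex launch set. -/

namespace Game

variable {n : ℕ} {G : Game n} [IsProbabilityMeasure G.F] {α β : Fin n → ℝ}
  {𝓜 : ∀ t : Test, MessageSpace t}

/-- Proposing with probability `w + l * (1 - w)`. -/
theorem le_privateValue_of_raise (hu : ∀ θ, G.u θ = θ) (hv : ∀ i θ, G.v i θ = α i * θ + β i)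
    (hc : 0 < G.c) (hk : G.k ≤ n) (hε : G.ε ∈ Set.Ioo (0 : ℝ) 1) {w : State → unitInterval}
    (hw : Measurable w) {T P T₀ P₀ l : ℝ} (hP : ∫ θ, (w θ : ℝ) ∂G.F = P)
    (hT : ∫ θ, (θ : ℝ) * (w θ : ℝ) ∂G.F = T) (hP₀ : ∫ θ, (1 - (w θ : ℝ)) ∂G.F = P₀)
    (hT₀ : ∫ θ, (θ : ℝ) * (1 - (w θ : ℝ)) ∂G.F = T₀) (hl : l ∈ Set.Icc (0 : ℝ) 1)
    (hPpos : 0 < P + l * P₀) {a : Fin n → unitInterval} {V : ℝ}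
    (hV : launchProb G.k (fun i => (1 - G.ε) * (a i : ℝ) + G.ε / 2) = V)
    (hpos : ∀ i, 0 < α i * ((T + l * T₀) / (P + l * P₀)) + β i → (a i : ℝ) = 1)
    (hneg : ∀ i, α i * ((T + l * T₀) / (P + l * P₀)) + β i < 0 → (a i : ℝ) = 0)
    (hprop : G.c * (P + l * P₀) ≤ V * (T + l * T₀))
    (hforgo : V * ((1 - l) * T₀) ≤ G.c * ((1 - l) * P₀)) :
    V * (T + l * T₀) - G.c * (P + l * P₀) ≤ G.privateValue 𝓜 := by
  let w' : State → unitInterval := fun θ => ⟨w θ + l * (1 - w θ), by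
    have h0 := (w θ).2.1
    have h1 := (w θ).2.2
    exact ⟨add_nonneg h0 (mul_nonneg hl.1 (by linarith)), by nlinarith [hl.2]⟩⟩
  have hw' : Measurable w' := by
    refine Measurable.subtype_mk ?_
    exact (measurable_subtype_coe.comp hw).add
      ((measurable_const.sub (measurable_subtype_coe.comp hw)).const_mul l)
  have i1 : Integrable (fun θ : State => (w θ : ℝ)) G.F := integrable_signalWeight hw true
  have i2 : Integrable (fun θ : State => 1 - (w θ : ℝ)) G.F := integrable_signalWeight hw false
  have i3 : Integrable (fun θ : State => (θ : ℝ) * (w θ : ℝ)) G.F :=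
    integrable_coe_mul_signalWeight hw true
  have i4 : Integrable (fun θ : State => (θ : ℝ) * (1 - (w θ : ℝ))) G.F :=
    integrable_coe_mul_signalWeight hw false
  have e1 : ∫ θ, (w' θ : ℝ) ∂G.F = P + l * P₀ := by
    rw [← hP, ← hP₀, ← integral_const_mul, ← integral_add i1 (i2.const_mul l)]
  have e2 : ∫ θ, (θ : ℝ) * (w' θ : ℝ) ∂G.F = T + l * T₀ := by
    rw [← hT, ← hT₀, ← integral_const_mul, ← integral_add i3 (i4.const_mul l)]
    exact integral_congr_ae (Eventually.of_forall fun θ => by simp only [w']; ring)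
  have e3 : ∫ θ, (1 - (w' θ : ℝ)) ∂G.F = (1 - l) * P₀ := by
    rw [← hP₀, ← integral_const_mul]
    exact integral_congr_ae (Eventually.of_forall fun θ => by simp only [w']; ring)
  have e4 : ∫ θ, (θ : ℝ) * (1 - (w' θ : ℝ)) ∂G.F = (1 - l) * T₀ := by
    rw [← hT₀, ← integral_const_mul]
    exact integral_congr_ae (Eventually.of_forall fun θ => by simp only [w']; ring)
  have := le_privateValue (𝓜 := 𝓜) hu hv hc hk hε hw' (by rw [e1]; exact hPpos) hV
    (z := (T + l * T₀) / (P + l * P₀)) (by rw [e1, e2]) hpos hneg (by rw [e1, e2]; exact hprop)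
    (by rw [e3, e4]; exact hforgo)
  rwa [e1, e2] at this

/-- Revealing only the proposal makes `T / P` the agents' posterior mean, which suffices for
approval but may push the launch probability above `V` and destroy the incentive to forgo. Pooling
forgone states into the proposal repairs this. With `e = n * ε / 2`, at most `e` is lost on the
states already proposed and at most `e` on those added. -/
theorem le_privateValue_add (hα : ∀ i, α i = -1 ∨ α i = 1)
    (hβ : ∀ i, β i ∈ Set.Ioo (-1 : ℝ) 1)
    (hδ : ∀ i j, i ≠ j → threshold α β i ≠ threshold α β j)
    (hδ₀ : ∀ i, α i = -1 → threshold α β i ≠ 0)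
    (hu : ∀ θ, G.u θ = θ) (hv : ∀ i θ, G.v i θ = α i * θ + β i)
    (hc : 0 < G.c) (hk : G.k ≤ n) (hε : G.ε ∈ Set.Ioo (0 : ℝ) 1) {w : State → unitInterval}
    (hw : Measurable w) {V T P T₀ P₀ : ℝ} (hP : ∫ θ, (w θ : ℝ) ∂G.F = P)
    (hT : ∫ θ, (θ : ℝ) * (w θ : ℝ) ∂G.F = T) (hP₀ : ∫ θ, (1 - (w θ : ℝ)) ∂G.F = P₀)
    (hT₀ : ∫ θ, (θ : ℝ) * (1 - (w θ : ℝ)) ∂G.F = T₀) (hV : V ∈ Set.Icc (0 : ℝ) 1)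
    (hPpos : 0 < P) (hforgo : V * T₀ ≤ G.c * P₀) (hy : n * G.ε < V * T - G.c * P)
    (hz : T / P ∈ launchSet G.k α β) :
    V * T - G.c * P ≤ G.privateValue 𝓜 + n * G.ε := by
  obtain ⟨e, he⟩ : ∃ e, e = n * (G.ε / 2) := ⟨_, rfl⟩
  have he0 : 0 ≤ e := by rw [he]; exact mul_nonneg (Nat.cast_nonneg n) (by linarith [hε.1])
  have hne : n * G.ε = 2 * e := by rw [he]; ring
  rw [hne] at hy ⊢
  have i1 : Integrable (fun θ : State => (w θ : ℝ)) G.F := integrable_signalWeight hw true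
  have i2 : Integrable (fun θ : State => 1 - (w θ : ℝ)) G.F := integrable_signalWeight hw false
  have i3 : Integrable (fun θ : State => (θ : ℝ) * (w θ : ℝ)) G.F :=
    integrable_coe_mul_signalWeight hw true
  have i4 : Integrable (fun θ : State => (θ : ℝ) * (1 - (w θ : ℝ))) G.F :=
    integrable_coe_mul_signalWeight hw false
  have hP₀0 : 0 ≤ P₀ := by
    rw [← hP₀]; exact integral_nonneg fun θ => sub_nonneg.2 (w θ).2.2
  have hTP : T ≤ P := by
    rw [← hT, ← hP]
    exact integral_mono i3 i1 fun θ => mul_le_of_le_one_left (w θ).2.1 θ.2.2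
  have hTP₀ : T₀ ≤ P₀ := by
    rw [← hT₀, ← hP₀]
    exact integral_mono i4 i2 fun θ => mul_le_of_le_one_left (sub_nonneg.2 (w θ).2.2) θ.2.2
  have hsum : P + P₀ = 1 := by
    rw [← hP, ← hP₀, ← integral_add i1 i2]
    simp
  have hcP : 0 < G.c * P := mul_pos hc hPpos
  have hT1 : T ≤ 1 := by linarith
  have hTpos : 0 < T := by
    by_contra h
    have := mul_nonpos_of_nonneg_of_nonpos hV.1 (not_lt.1 h)
    linarith
  have hV2e : 2 * e < V := by
    have : V * T ≤ V * 1 := mul_le_mul_of_nonneg_left hT1 hV.1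
    linarith
  -- a launch probability of at least `1 - e` costs at most `e` relative to `V`
  have hlow : ∀ V', 1 - e ≤ V' → V * T - e ≤ V' * T := fun V' h => by
    nlinarith [hV.2, mul_nonneg he0 (sub_nonneg.2 hT1)]
  have hpure : ∀ {μ}, μ ∈ launchSet G.k α β → 1 - e ≤ launchProb G.k
      (fun i => (1 - G.ε) * (approve α β μ i : ℝ) + G.ε / 2) := fun h => by
    rw [he]; exact le_launchProb_approve hk hε ((mem_launchSet_iff hα).1 h).2
  obtain ⟨V', hV'⟩ : ∃ V', V' = launchProb G.k
      (fun i => (1 - G.ε) * (approve α β (T / P) i : ℝ) + G.ε / 2) := ⟨_, rfl⟩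
  have hV'e : 1 - e ≤ V' := by rw [hV']; exact hpure hz
  have hV'1 : V' ≤ 1 := by
    rw [hV']; exact launchProb_le_one hk fun i => tremble_mem_unit hε _
  have hV'T := hlow V' hV'e
  -- If forgoing stays optimal at the new launch probability, the proposal rule is kept unchanged.
  by_cases hcase : V' * T₀ ≤ G.c * P₀
  · have := le_privateValue_of_raise (𝓜 := 𝓜) (l := 0) hu hv hc hk hε hw hP hT hP₀ hT₀
      ⟨le_rfl, zero_le_one⟩ (by linarith) hV'.symm
      (fun i hi => approve_of_nonneg (by simpa using hi.le))
      (fun i hi => approve_of_neg (by simpa using hi)) (by linarith) (by linarith)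
    simp only [zero_mul, add_zero] at this
    linarith
  · have hcase' := not_le.1 hcase
    have hcP₀ : 0 ≤ G.c * P₀ := mul_nonneg hc.le hP₀0
    have hT₀pos : 0 < T₀ := by
      by_contra h
      have := mul_nonpos_of_nonneg_of_nonpos (show 0 ≤ V' by linarith [hV.2]) (not_lt.1 h)
      linarith
    have hT₀1 : T₀ ≤ 1 := by linarith
    have hT₀c : G.c * P₀ < T₀ := by nlinarith
    -- launching in the forgone states loses at most `e`
    have hlow₀ : ∀ V'', 1 - e ≤ V'' → G.c * P₀ - e ≤ V'' * T₀ := fun V'' h => by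
      nlinarith [mul_nonneg he0 (sub_nonneg.2 hT₀1)]
    by_cases hm : (T + T₀) / (P + P₀) ∈ launchSet G.k α β
    · obtain ⟨V₁, hV₁⟩ : ∃ V₁, V₁ = launchProb G.k
        (fun i => (1 - G.ε) * (approve α β ((T + T₀) / (P + P₀)) i : ℝ) + G.ε / 2) := ⟨_, rfl⟩
      have hV₁e : 1 - e ≤ V₁ := by rw [hV₁]; exact hpure hm
      have h1 := hlow V₁ hV₁e
      have h2 := hlow₀ V₁ hV₁e
      have := le_privateValue_of_raise (𝓜 := 𝓜) (l := 1) hu hv hc hk hε hw hP hT hP₀ hT₀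
        ⟨zero_le_one, le_rfl⟩ (by linarith) hV₁.symm
        (fun i hi => approve_of_nonneg (by simpa using hi.le))
        (fun i hi => approve_of_neg (by simpa using hi)) (by nlinarith) (by linarith)
      simp only [one_mul] at this
      nlinarith
    · obtain ⟨l, hl, hlΛ, hfr⟩ := exists_last_exit (isClosed_launchSet hα) hPpos hP₀0 hz hm
      have hden : ∀ r : ℝ, 0 ≤ r → 0 < P + r * P₀ := fun r hr =>
        add_pos_of_pos_of_nonneg hPpos (mul_nonneg hr hP₀0)
      obtain ⟨-, i, hi, hcard⟩ := exists_indifferent_of_boundary hα hβ hδ hδ₀ hlΛ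
        (hfr.mono (by
          rintro y ⟨hy, r, hr, rfl⟩
          refine ⟨⟨div_nonneg (add_nonneg hTpos.le (mul_nonneg hr.1 hT₀pos.le))
            (hden r hr.1).le, ?_⟩, hy⟩
          rw [div_le_one (hden r hr.1)]
          exact add_le_add hTP (mul_le_mul_of_nonneg_left hTP₀ hr.1)))
      -- `c * P₀ / T₀` is the launch probability that makes the principal indifferent about the
      -- forgone states, and it is at least `V`. The cap `1 - e` keeps `V₁` within reach of the
      -- mixed vote.
      obtain ⟨V₁, hV₁⟩ : ∃ V₁, V₁ = min (G.c * P₀ / T₀) (1 - e) := ⟨_, rfl⟩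
      have hVle : V ≤ G.c * P₀ / T₀ := by rwa [le_div_iff₀ hT₀pos]
      have hV₁0 : e ≤ V₁ := by
        rw [hV₁]; exact le_min (by linarith) (by linarith [hV.2])
      have hV₁T₀ : V₁ * T₀ ≤ G.c * P₀ := by
        rw [← le_div_iff₀ hT₀pos, hV₁]; exact min_le_left _ _
      have h1 : V * T - e ≤ V₁ * T := by
        rcases min_choice (G.c * P₀ / T₀) (1 - e) with h | h
        · rw [hV₁, h]
          have := mul_le_mul_of_nonneg_right hVle hTpos.le
          linarith
        · rw [hV₁, h]; exact hlow _ le_rfl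
      have h2 : G.c * P₀ - e ≤ V₁ * T₀ := by
        rcases min_choice (G.c * P₀ / T₀) (1 - e) with h | h
        · rw [hV₁, h, div_mul_cancel₀ _ hT₀pos.ne']
          linarith
        · rw [hV₁, h]; exact hlow₀ _ le_rfl
      obtain ⟨a, ha, hapos, haneg⟩ := exists_mixed_vote hk hε hi hcard (V := V₁)
        (by rw [← he]; exact hV₁0) (by rw [← he, hV₁]; exact min_le_right _ _)
      have hl2 := mul_le_mul_of_nonneg_left h2 hl.1
      rw [mul_sub] at hl2
      have hle : l * e ≤ e := mul_le_of_le_one_left he0 hl.2.le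
      have e1 : V₁ * (T + l * T₀) = V₁ * T + l * (V₁ * T₀) := by ring
      have e2 : G.c * (P + l * P₀) = G.c * P + l * (G.c * P₀) := by ring
      have e3 : V₁ * ((1 - l) * T₀) = (1 - l) * (V₁ * T₀) := by ring
      have e4 : G.c * ((1 - l) * P₀) = (1 - l) * (G.c * P₀) := by ring
      have := le_privateValue_of_raise (𝓜 := 𝓜) hu hv hc hk hε hw hP hT hP₀ hT₀
        ⟨hl.1, hl.2.le⟩ (hden l hl.1) ha hapos haneg (by rw [e1, e2]; linarith)
        (by rw [e3, e4]; exact mul_le_mul_of_nonneg_left hV₁T₀ (sub_nonneg.2 hl.2.le))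
      rw [e1, e2] at this
      linarith

theorem privateValue_nonneg (hu : ∀ θ, G.u θ = θ) (hc : 0 < G.c) (hk : G.k ≤ n)
    (hε : G.ε ∈ Set.Ioo (0 : ℝ) 1) : 0 ≤ G.privateValue 𝓜 := by
  refine Real.sSup_nonneg ?_
  rintro y ⟨t, ω, ⟨ρ, hρ, hω⟩, rfl⟩
  exact payoff_nonneg hu hc hk hε hρ hω

/-- If the launch set is convex, then public messaging has an advantage of at most the expected
number of mechanical agents. -/
theorem publicValue_le_privateValue_add (hα : ∀ i, α i = -1 ∨ α i = 1)
    (hβ : ∀ i, β i ∈ Set.Ioo (-1 : ℝ) 1)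
    (hδ : ∀ i j, i ≠ j → threshold α β i ≠ threshold α β j)
    (hδ₀ : ∀ i, α i = -1 → threshold α β i ≠ 0)
    (hu : ∀ θ, G.u θ = θ) (hv : ∀ i θ, G.v i θ = α i * θ + β i)
    (hc : 0 < G.c) (hk : G.k ≤ n) (hε : G.ε ∈ Set.Ioo (0 : ℝ) 1)
    (hΛ : Convex ℝ (launchSet G.k α β)) :
    G.publicValue 𝓜 ≤ G.privateValue 𝓜 + n * G.ε := by
  have hpri := privateValue_nonneg (𝓜 := 𝓜) hu hc hk hε
  have hnε : 0 ≤ n * G.ε := mul_nonneg (Nat.cast_nonneg n) hε.1.le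
  refine Real.sSup_le ?_ (add_nonneg hpri hnε)
  rintro y ⟨t, ω, ⟨ρ, hρ, hω⟩, rfl⟩
  -- Small payoffs are harmless, the private value being nonnegative. Larger ones force `V > n * ε /
  -- 2`, as the argument on votes needs.
  by_cases hy : G.payoff ω ≤ n * G.ε
  · linarith
  rw [not_le] at hy
  have hV : G.maxLaunch ρ ∈ Set.Icc (0 : ℝ) 1 := ⟨maxLaunch_nonneg hε, maxLaunch_le_one hk hε⟩
  have hforgo := forgone_le hu hc hk hε hρ hω
  have hw : Measurable ω.proposed := by
    have := measurable_proposed hω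
    exact this.subtype_mk (h := fun θ => (ω.proposed θ).2)
  rw [payoff_eq hu hc hk hε hρ hω] at hy ⊢
  have hP0 : 0 ≤ ∫ θ, (ω.proposed θ : ℝ) ∂G.F := integral_nonneg fun θ => (ω.proposed θ).2.1
  have hTP : ∫ θ, (θ : ℝ) * (ω.proposed θ : ℝ) ∂G.F ≤ ∫ θ, (ω.proposed θ : ℝ) ∂G.F :=
    integral_mono (integrable_coe_mul_proposed hω) (integrable_proposed hω)
      fun θ => mul_le_of_le_one_left (ω.proposed θ).2.1 θ.2.2
  have hP1 : ∫ θ, (ω.proposed θ : ℝ) ∂G.F ≤ 1 := by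
    have := integral_mono (integrable_proposed hω) (integrable_const (1 : ℝ))
      fun θ => (ω.proposed θ).2.2
    simpa using this
  have hcP := mul_nonneg hc.le hP0
  have hT0 : 0 < ∫ θ, (θ : ℝ) * (ω.proposed θ : ℝ) ∂G.F := by
    by_contra h
    have := mul_nonpos_of_nonneg_of_nonpos hV.1 (not_lt.1 h)
    linarith
  have hP : 0 < ∫ θ, (ω.proposed θ : ℝ) ∂G.F := by linarith
  refine le_privateValue_add hα hβ hδ hδ₀ hu hv hc hk hε hw rfl rfl rfl rfl hV hP hforgo hy ?_
  -- With `k = 0` nobody is pivotal, but the launch set is all of `[0, 1]`.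
  rcases Nat.eq_zero_or_pos G.k with hk0 | hk₁
  · rw [mem_launchSet_iff hα, hk0]
    exact ⟨⟨div_nonneg hT0.le hP.le, (div_le_one hP).2 hTP⟩, Nat.zero_le _⟩
  · refine mem_launchSet_public hα hΛ hu hv hc hk₁ hk hε hρ hω hP ?_
    have := mul_le_mul_of_nonneg_left (hTP.trans hP1) hV.1
    linarith

end Game

/-! ### A prior for which public messaging wins when the launch set has a gap. -/

theorem integral_coe_unitInterval : ∫ t : unitInterval, (t : ℝ) = 1 / 2 := by
  rw [integral_subtype (s := Set.Icc (0 : ℝ) 1) measurableSet_Icc (fun t => t),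
    integral_Icc_eq_integral_Ioc, ← intervalIntegral.integral_of_le zero_le_one, integral_id]
  norm_num

/-- The uniform law on `[x - r, x + r]`. -/
theorem exists_atomless_law_near {x r : ℝ} (hr : 0 < r) (h₁ : -1 ≤ x - r) (h₂ : x + r ≤ 1) :
    ∃ μ : Measure State, IsProbabilityMeasure μ ∧ NullSingletonClass μ ∧
      ∫ θ, (θ : ℝ) ∂μ = x ∧ ∀ᵐ θ : State ∂μ, (θ : ℝ) ∈ Set.Icc (x - r) (x + r) := by
  have hmem : ∀ t : unitInterval, x + r * (2 * (t : ℝ) - 1) ∈ Set.Icc (x - r) (x + r) := fun t =>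
    ⟨by nlinarith [t.2.1], by nlinarith [t.2.2]⟩
  let f : unitInterval → State := fun t => ⟨x + r * (2 * (t : ℝ) - 1),
    h₁.trans (hmem t).1, (hmem t).2.trans h₂⟩
  have hf : Measurable f := by
    refine Measurable.subtype_mk ?_
    exact ((measurable_subtype_coe.const_mul 2).sub_const 1).const_mul r |>.const_add x
  have hinj : Function.Injective f := fun s t hst => by
    have h : x + r * (2 * (s : ℝ) - 1) = x + r * (2 * (t : ℝ) - 1) := congrArg Subtype.val hst
    have h' := mul_left_cancel₀ hr.ne' (add_left_cancel h)
    exact Subtype.ext (by linarith)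
  refine ⟨(volume : Measure unitInterval).map f, Measure.isProbabilityMeasure_map hf.aemeasurable,
    ⟨fun θ => ?_⟩, ?_, ?_⟩
  · rw [Measure.map_apply hf (measurableSet_singleton θ)]
    exact (Set.subsingleton_singleton.preimage hinj).measure_zero _
  · rw [integral_map hf.aemeasurable measurable_subtype_coe.aestronglyMeasurable]
    have hi : Integrable (fun t : unitInterval => (t : ℝ)) :=
      integrable_coe_unitInterval measurable_id
    have : ∫ t : unitInterval, (x + r * (2 * (t : ℝ) - 1)) =
        x + r * (2 * (∫ t : unitInterval, (t : ℝ)) - 1) := by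
      have hi' : Integrable (fun t : unitInterval => 2 * (t : ℝ) - 1) :=
        (hi.const_mul 2).sub (integrable_const _)
      rw [integral_add (integrable_const _) (hi'.const_mul r), integral_const_mul, integral_sub (hi.const_mul 2) (integrable_const _), integral_const_mul]
      simp
    refine this.trans ?_
    rw [integral_coe_unitInterval]
    ring
  · rw [ae_map_iff hf.aemeasurable (measurable_subtype_coe measurableSet_Icc)]
    exact Eventually.of_forall hmem

/-- An atomless prior with half of its mass near each of two positive states, and a binary test
that tells the two halves apart. -/
theorem exists_two_lump_prior {x y : ℝ} (hx : 0 < x) (hxy : x < y) (hy : y < 1) :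
    ∃ F : Measure State, IsProbabilityMeasure F ∧ NullSingletonClass F ∧
      (∀ᵐ θ : State ∂F, x / 2 ≤ (θ : ℝ)) ∧ ∃ w : State → unitInterval, Measurable w ∧
        (∀ s, ∫ θ, signalWeight w s θ ∂F = 1 / 2) ∧
        ∫ θ, (θ : ℝ) * signalWeight w true θ ∂F = x / 2 ∧
        ∫ θ, (θ : ℝ) * signalWeight w false θ ∂F = y / 2 := by
  -- The three bounds keep all states above `x / 2`, keep them below `1`, and separate the two lumps
  -- by the midpoint `(x + y) / 2`.
  obtain ⟨r, hr0, hrx, hry, hrxy⟩ : ∃ r : ℝ, 0 < r ∧ r ≤ x / 2 ∧ r ≤ 1 - y ∧ r ≤ (y - x) / 4 :=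
    ⟨min (x / 2) (min (1 - y) ((y - x) / 4)),
      lt_min (by linarith) (lt_min (by linarith) (by linarith)), min_le_left _ _,
      (min_le_right _ _).trans (min_le_left _ _), (min_le_right _ _).trans (min_le_right _ _)⟩
  obtain ⟨μ, hμ, hμ0, hμm, hμs⟩ := exists_atomless_law_near (x := x) hr0 (by linarith)
    (by linarith)
  obtain ⟨ν, hν, hν0, hνm, hνs⟩ := exists_atomless_law_near (x := y) hr0 (by linarith)
    (by linarith)
  let F : Measure State := (2⁻¹ : ENNReal) • μ + (2⁻¹ : ENNReal) • ν
  have hint : ∀ f : State → ℝ, Integrable f μ → Integrable f ν →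
      ∫ θ, f θ ∂F = (∫ θ, f θ ∂μ) / 2 + (∫ θ, f θ ∂ν) / 2 := fun f h1 h2 => by
    rw [integral_add_measure (h1.smul_measure (by simp)) (h2.smul_measure (by simp)),
      integral_smul_measure, integral_smul_measure]
    simp only [ENNReal.toReal_inv, ENNReal.toReal_ofNat, smul_eq_mul]
    ring
  let w : State → unitInterval := fun θ =>
    open Classical in if (θ : ℝ) < (x + y) / 2 then 1 else 0
  have hw : Measurable w := Measurable.ite
    (measurableSet_lt measurable_subtype_coe measurable_const) measurable_const measurable_const
  have hwμ : ∀ᵐ θ ∂μ, (w θ : ℝ) = 1 := by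
    filter_upwards [hμs] with θ hθ
    simp only [w]
    rw [if_pos (by linarith [hθ.2]), Set.Icc.coe_one]
  have hwν : ∀ᵐ θ ∂ν, (w θ : ℝ) = 0 := by
    filter_upwards [hνs] with θ hθ
    simp only [w]
    rw [if_neg (by linarith [hθ.1]), Set.Icc.coe_zero]
  have hθ1 : ∀ᵐ θ ∂μ, signalWeight w true θ = 1 ∧ signalWeight w false θ = 0 := by
    filter_upwards [hwμ] with θ h
    simp [signalWeight, h]
  have hθ2 : ∀ᵐ θ ∂ν, signalWeight w true θ = 0 ∧ signalWeight w false θ = 1 := by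
    filter_upwards [hwν] with θ h
    simp [signalWeight, h]
  refine ⟨F, ⟨?_⟩, ⟨fun θ => ?_⟩, ?_, w, hw, fun s => ?_, ?_, ?_⟩
  · simp only [F, Measure.add_apply, Measure.smul_apply, measure_univ, smul_eq_mul, mul_one]
    exact ENNReal.inv_two_add_inv_two
  · simp only [F, Measure.add_apply, Measure.smul_apply, measure_singleton, smul_zero, add_zero]
  · rw [ae_add_measure_iff]
    constructor
    · refine Measure.ae_smul_measure ?_ _
      filter_upwards [hμs] with θ hθ
      linarith [hθ.1]
    · refine Measure.ae_smul_measure ?_ _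
      filter_upwards [hνs] with θ hθ
      linarith [hθ.1]
  · rw [hint _ (integrable_signalWeight hw s) (integrable_signalWeight hw s)]
    cases s
    · rw [integral_congr_ae (hθ1.mono fun θ h => h.2), integral_congr_ae (hθ2.mono fun θ h => h.2)]
      simp
    · rw [integral_congr_ae (hθ1.mono fun θ h => h.1), integral_congr_ae (hθ2.mono fun θ h => h.1)]
      simp
  · rw [hint _ (integrable_coe_mul_signalWeight hw _) (integrable_coe_mul_signalWeight hw _),
      integral_congr_ae (g := fun θ : State => (θ : ℝ))
        (hθ1.mono fun θ h => by simp only [h.1, mul_one]),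
      integral_congr_ae (g := fun θ : State => (0 : ℝ))
        (hθ2.mono fun θ h => by simp only [h.1, mul_zero]), hμm]
    simp
  · rw [hint _ (integrable_coe_mul_signalWeight hw _) (integrable_coe_mul_signalWeight hw _),
      integral_congr_ae (g := fun θ : State => (0 : ℝ))
        (hθ1.mono fun θ h => by simp only [h.2, mul_zero]),
      integral_congr_ae (g := fun θ : State => (θ : ℝ))
        (hθ2.mono fun θ h => by simp only [h.2, mul_one]), hνm]
    simp

theorem integral_coe_eq_add {F : Measure State} [IsFiniteMeasure F] {w : State → unitInterval}
    (hw : Measurable w) : ∫ θ, (θ : ℝ) ∂F = ∫ θ, (θ : ℝ) * signalWeight w true θ ∂F +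
      ∫ θ, (θ : ℝ) * signalWeight w false θ ∂F := by
  rw [← integral_add (integrable_coe_mul_signalWeight hw true)
    (integrable_coe_mul_signalWeight hw false)]
  refine integral_congr_ae (Eventually.of_forall fun θ => ?_)
  simp only [signalWeight, if_true, Bool.false_eq_true, if_false]
  ring

/-- Only the number of approvals matters: a permutation carries one set of supporters to the other.
-/
theorem launchProb_approve_eq {n k : ℕ} {α β : Fin n → ℝ} {x y ε : ℝ}
    (h : (Finset.univ.filter fun i => 0 ≤ α i * x + β i).card =
      (Finset.univ.filter fun i => 0 ≤ α i * y + β i).card) :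
    launchProb k (fun i => (1 - ε) * (approve α β x i : ℝ) + ε / 2) =
      launchProb k (fun i => (1 - ε) * (approve α β y i : ℝ) + ε / 2) := by
  obtain ⟨e, he⟩ := exists_perm_mem_iff h
  rw [← launchProb_comp_perm (fun i => (1 - ε) * (approve α β y i : ℝ) + ε / 2) e]
  congr 1
  ext i
  have := he i
  simp only [Finset.mem_filter, Finset.mem_univ, true_and] at this
  by_cases hi : 0 ≤ α i * x + β i
  · simp only [Function.comp, approve_of_nonneg hi, approve_of_nonneg (this.2 hi)]
  · have hi' : ¬ 0 ≤ α (e i) * y + β (e i) := fun h' => hi (this.1 h')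
    simp only [Function.comp, approve_of_neg (not_le.1 hi), approve_of_neg (not_le.1 hi')]

/-- A launch set that is not convex has a gap between two points at which exactly `k` agents
approve. -/
theorem exists_gap {n k : ℕ} {α β : Fin n → ℝ} (hα : ∀ i, α i = -1 ∨ α i = 1)
    (hβ : ∀ i, β i ∈ Set.Ioo (-1 : ℝ) 1)
    (hδ : ∀ i j, i ≠ j → threshold α β i ≠ threshold α β j)
    (hδ₀ : ∀ i, α i = -1 → threshold α β i ≠ 0) (hΛ : ¬ Convex ℝ (launchSet k α β)) :
    ∃ x y : ℝ, 0 < x ∧ x < y ∧ y < 1 ∧ (∀ z ∈ launchSet k α β, z ≤ x ∨ y ≤ z) ∧ 1 ≤ k ∧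
      (Finset.univ.filter fun i => 0 ≤ α i * x + β i).card = k ∧
      (Finset.univ.filter fun i => 0 ≤ α i * y + β i).card = k := by
  have hcl := isClosed_launchSet (k := k) (β := β) hα
  have h01 : launchSet k α β ⊆ Set.Icc 0 1 := fun z hz => hz.1
  rw [convex_iff_ordConnected, Set.ordConnected_def] at hΛ
  push Not at hΛ
  obtain ⟨p, hp, r, hr, hpr⟩ := hΛ
  obtain ⟨q, hq, hqΛ⟩ := Set.not_subset.1 hpr
  have hcomp : IsCompact (launchSet k α β) := isCompact_Icc.of_isClosed_subset hcl h01
  -- The gap around a missing point `q` runs from the last point of the launch set before `q` to the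
  -- next one after it.
  obtain ⟨x, ⟨hxΛ, hxq⟩, hxmax⟩ := (hcomp.inter_right isClosed_Iic).exists_isGreatest
    (s := launchSet k α β ∩ Set.Iic q) ⟨p, hp, hq.1⟩
  obtain ⟨y, ⟨hyΛ, hyq⟩, hymin⟩ := (hcomp.inter_right isClosed_Ici).exists_isLeast
    (s := launchSet k α β ∩ Set.Ici q) ⟨r, hr, hq.2⟩
  have hxq' : x < q := lt_of_le_of_ne hxq fun h => hqΛ (h ▸ hxΛ)
  have hyq' : q < y := lt_of_le_of_ne hyq fun h => hqΛ (h ▸ hyΛ)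
  have hfx : ∃ᶠ z in 𝓝 x, z ∈ Set.Icc (0 : ℝ) 1 ∧ z ∉ launchSet k α β := by
    have h : ∃ᶠ z in 𝓝[>] x, z ∈ Set.Icc (0 : ℝ) 1 ∧ z ∉ launchSet k α β := by
      refine Eventually.frequently ?_
      filter_upwards [Ioo_mem_nhdsGT hxq'] with z hz
      exact ⟨⟨(h01 hxΛ).1.trans hz.1.le, (hz.2.trans hyq').le.trans (h01 hyΛ).2⟩,
        fun hzΛ => absurd (hxmax ⟨hzΛ, hz.2.le⟩) (not_le.2 hz.1)⟩
    exact h.filter_mono nhdsWithin_le_nhds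
  have hfy : ∃ᶠ z in 𝓝 y, z ∈ Set.Icc (0 : ℝ) 1 ∧ z ∉ launchSet k α β := by
    have h : ∃ᶠ z in 𝓝[<] y, z ∈ Set.Icc (0 : ℝ) 1 ∧ z ∉ launchSet k α β := by
      refine Eventually.frequently ?_
      filter_upwards [Ioo_mem_nhdsLT hyq'] with z hz
      exact ⟨⟨(h01 hxΛ).1.trans (hxq'.trans hz.1).le, hz.2.le.trans (h01 hyΛ).2⟩,
        fun hzΛ => absurd (hymin ⟨hzΛ, hz.1.le⟩) (not_le.2 hz.2)⟩
    exact h.filter_mono nhdsWithin_le_nhds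
  obtain ⟨hx01, i, hi, hxk⟩ := exists_indifferent_of_boundary hα hβ hδ hδ₀ hxΛ hfx
  obtain ⟨hy01, -, -, hyk⟩ := exists_indifferent_of_boundary hα hβ hδ hδ₀ hyΛ hfy
  refine ⟨x, y, hx01.1, hxq'.trans hyq', hy01.2, fun z hz => ?_, ?_, hxk, hyk⟩
  · rcases le_total z q with h | h
    · exact Or.inl (hxmax ⟨hz, h⟩)
    · exact Or.inr (hymin ⟨hz, h⟩)
  · rw [← hxk, Nat.one_le_iff_ne_zero, Finset.card_ne_zero]
    exact ⟨i, by simp [hi]⟩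

namespace Game

variable {n : ℕ} {G : Game n} [IsProbabilityMeasure G.F] {α β : Fin n → ℝ}
  {𝓜 : ∀ t : Test, MessageSpace t}

/-- Under private messaging, a prior mean in the middle of a gap of the launch set forces the
principal to forgo the project with a probability that is bounded below. -/
theorem privateValue_le_of_gap (hα : ∀ i, α i = -1 ∨ α i = 1)
    (hu : ∀ θ, G.u θ = θ) (hv : ∀ i θ, G.v i θ = α i * θ + β i) (hk₁ : 1 ≤ G.k)
    (hk : G.k ≤ n) (hε : G.ε ∈ Set.Ioo (0 : ℝ) 1) {x y : ℝ} (hx : 0 < x) (hxy : x < y)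
    (hy : y < 1) (hgap : ∀ z ∈ launchSet G.k α β, z ≤ x ∨ y ≤ z) (hc : G.c = x / 4)
    (hsupp : ∀ᵐ θ : State ∂G.F, x / 2 ≤ (θ : ℝ)) (hmean : ∫ θ, (θ : ℝ) ∂G.F = (x + y) / 2)
    (hεx : n * (G.ε / 2) ≤ x / 2) :
    G.privateValue 𝓜 ≤ (x + y) / 2 - G.c - x / 8 * (y - x) := by
  have hbound : x / 2 ≤ (x + y) / 2 - G.c - x / 8 * (y - x) := by rw [hc]; nlinarith
  refine Real.sSup_le ?_ (le_trans (by linarith) hbound)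
  rintro _ ⟨t, ω, ⟨ρ, hρ, hω⟩, rfl⟩
  have hc0 : 0 < G.c := by rw [hc]; linarith
  have hV0 : 0 ≤ G.maxLaunch ρ := maxLaunch_nonneg hε
  have hV1 : G.maxLaunch ρ ≤ 1 := maxLaunch_le_one hk hε
  have hpriv := le_card_approving_private hu hv hc0 hk₁ hk hε hρ hω
  rw [payoff_eq hu hc0 hk hε hρ hω]
  have i1 := integrable_proposed hω
  have i3 := integrable_coe_mul_proposed hω
  have i2 : Integrable (fun θ : State => 1 - (ω.proposed θ : ℝ)) G.F :=
    (integrable_const 1).sub i1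
  have i0 : Integrable (fun θ : State => (θ : ℝ)) G.F := integrable_coe_state measurable_id
  have i4 : Integrable (fun θ : State => (θ : ℝ) * (1 - (ω.proposed θ : ℝ))) G.F := by
    have := i0.sub i3
    refine this.congr (Eventually.of_forall fun θ => ?_)
    simp only [Pi.sub_apply]
    ring
  have hP₀ : ∫ θ, (1 - (ω.proposed θ : ℝ)) ∂G.F = 1 - ∫ θ, (ω.proposed θ : ℝ) ∂G.F := by
    rw [integral_sub (integrable_const _) i1]
    simp
  have hT₀ : ∫ θ, (θ : ℝ) * (1 - (ω.proposed θ : ℝ)) ∂G.F =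
      (x + y) / 2 - ∫ θ, (θ : ℝ) * (ω.proposed θ : ℝ) ∂G.F := by
    rw [← hmean, ← integral_sub i0 i3]
    exact integral_congr_ae (Eventually.of_forall fun θ => by ring)
  have hP0 : 0 ≤ ∫ θ, (ω.proposed θ : ℝ) ∂G.F := integral_nonneg fun θ => (ω.proposed θ).2.1
  have hP₀0 : 0 ≤ ∫ θ, (1 - (ω.proposed θ : ℝ)) ∂G.F :=
    integral_nonneg fun θ => sub_nonneg.2 (ω.proposed θ).2.2
  have hTP : ∫ θ, (θ : ℝ) * (ω.proposed θ : ℝ) ∂G.F ≤ ∫ θ, (ω.proposed θ : ℝ) ∂G.F :=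
    integral_mono i3 i1 fun θ => mul_le_of_le_one_left (ω.proposed θ).2.1 θ.2.2
  have hTP₀ : ∫ θ, (θ : ℝ) * (1 - (ω.proposed θ : ℝ)) ∂G.F ≤
      ∫ θ, (1 - (ω.proposed θ : ℝ)) ∂G.F :=
    integral_mono i4 i2 fun θ => mul_le_of_le_one_left (sub_nonneg.2 (ω.proposed θ).2.2) θ.2.2
  have hT0 : 0 ≤ ∫ θ, (θ : ℝ) * (ω.proposed θ : ℝ) ∂G.F := by
    refine integral_nonneg_of_ae ?_
    filter_upwards [hsupp] with θ hθ
    exact mul_nonneg (by linarith) (ω.proposed θ).2.1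
  have hT₀0 : x / 2 * ∫ θ, (1 - (ω.proposed θ : ℝ)) ∂G.F ≤
      ∫ θ, (θ : ℝ) * (1 - (ω.proposed θ : ℝ)) ∂G.F := by
    rw [← integral_const_mul]
    refine integral_mono_ae (i2.const_mul _) i4 ?_
    filter_upwards [hsupp] with θ hθ
    exact mul_le_mul_of_nonneg_right hθ (sub_nonneg.2 (ω.proposed θ).2.2)
  rw [hP₀] at hP₀0 hTP₀ hT₀0
  rw [hT₀] at hTP₀ hT₀0
  generalize ∫ θ, (ω.proposed θ : ℝ) ∂G.F = P at *
  generalize ∫ θ, (θ : ℝ) * (ω.proposed θ : ℝ) ∂G.F = T at *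
  have hcP := mul_nonneg hc0.le hP0
  -- If launches are no likelier than trembles explain, the payoff is at most `x / 2`, already below
  -- the bound.
  by_cases hVε : G.maxLaunch ρ ≤ n * (G.ε / 2)
  · have : G.maxLaunch ρ * T ≤ G.maxLaunch ρ * 1 :=
      mul_le_mul_of_nonneg_left (by linarith) hV0
    linarith
  rcases hP0.lt_or_eq with hP | hP
  · have hcard := hpriv hP (not_le.1 hVε)
    have hz0 : 0 ≤ T / P := div_nonneg hT0 hP0
    have hz1 : T / P ≤ 1 := (div_le_one hP).2 hTP
    have hT : T = T / P * P := (div_mul_cancel₀ T hP.ne').symm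
    have hmem := hgap (T / P) ((mem_launchSet_iff hα).2 ⟨⟨hz0, hz1⟩, hcard⟩)
    generalize T / P = z at *
    -- The overall mean is the midpoint of the gap, while the mean given a proposal is at most `x`
    -- or at least `y`. States lie in `[0, 1]`, so the forgone mass must bridge a distance of `(y -
    -- x) / 2`.
    have hforgo : (y - x) / 2 ≤ 1 - P := by
      rcases hmem with h | h
      · have := mul_nonneg hz0 hP₀0
        linarith
      · have := mul_le_mul_of_nonneg_right hz1 hP₀0
        have := mul_nonneg (show 0 ≤ x / 2 by linarith) hP₀0
        linarith
    have h1 : G.maxLaunch ρ * T ≤ T := mul_le_of_le_one_left hT0 hV1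
    -- Each forgone state is worth at least `x / 2`, and proposing costs `x / 4`, so each unit of
    -- forgone mass loses at least `x / 4`.
    have h2 := mul_le_mul_of_nonneg_left hforgo (show 0 ≤ x / 4 by linarith)
    rw [hc]
    linarith
  · have : T ≤ 0 := by linarith
    have := mul_nonpos_of_nonneg_of_nonpos hV0 this
    linarith

theorem le_publicValue_of_gap (hu : ∀ θ, G.u θ = θ) (hv : ∀ i θ, G.v i θ = α i * θ + β i)
    (hk : G.k ≤ n) (hε : G.ε ∈ Set.Ioo (0 : ℝ) 1) {x y : ℝ} (hx : 0 < x) (hxy : x < y)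
    (hy : y < 1) (hc : G.c = x / 4) {w : State → unitInterval} (hw : Measurable w)
    (hP : ∀ s, ∫ θ, signalWeight w s θ ∂G.F = 1 / 2)
    (hTx : ∫ θ, (θ : ℝ) * signalWeight w true θ ∂G.F = x / 2)
    (hTy : ∫ θ, (θ : ℝ) * signalWeight w false θ ∂G.F = y / 2)
    (hxk : (Finset.univ.filter fun i => 0 ≤ α i * x + β i).card = G.k)
    (hyk : (Finset.univ.filter fun i => 0 ≤ α i * y + β i).card = G.k)
    (hε' : n * (G.ε / 2) ≤ 1 / 2) :
    (x + y) / 2 - n * (G.ε / 2) - G.c ≤ G.publicValue 𝓜 := by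
  have hmean : ∫ θ, (θ : ℝ) ∂G.F = (x + y) / 2 := by
    rw [integral_coe_eq_add hw, hTx, hTy, add_div]
  obtain ⟨V, hVdef⟩ : ∃ V, V = launchProb G.k
    (fun i => (1 - G.ε) * (approve α β x i : ℝ) + G.ε / 2) := ⟨_, rfl⟩
  have hV : 1 - n * (G.ε / 2) ≤ V := by
    rw [hVdef]; exact le_launchProb_approve hk hε hxk.ge
  have h := le_publicValue (𝓜 := 𝓜) (w := w) (V := V) (z := fun s => if s then x else y)
    (a := fun s => approve α β (if s then x else y)) hu hv hk hε hw
    (fun s => by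
      cases s
      · rw [hVdef]
        -- The supporters at `x` and `y` may differ, but there are `k` of them at both, so neither
        -- report is more attractive.
        exact launchProb_approve_eq (hyk.trans hxk.symm)
      · exact hVdef.symm)
    (fun s => by rw [hP]; norm_num)
    (fun s => by
      rw [hP]
      cases s
      · rw [hTy]; simp
      · rw [hTx]; simp)
    (fun s i hi => approve_of_nonneg hi.le) (fun s i hi => approve_of_neg hi)
    (fun s => by
      rw [hc]
      cases s
      · simp only [Bool.false_eq_true, if_false]; nlinarith
      · simp only [if_true]; nlinarith)
  rw [hmean] at h
  have hn : 0 ≤ n * (G.ε / 2) := mul_nonneg (Nat.cast_nonneg n) (by linarith [hε.1])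
  nlinarith

end Game

theorem mainTheorem7 {n k : ℕ} (hn : 2 ≤ n) (hk : k ≤ n) (α β : Fin n → ℝ)
    (hα : ∀ i, α i = -1 ∨ α i = 1) (hβ : ∀ i, β i ∈ Set.Ioo (-1 : ℝ) 1)
    (hδ : ∀ i j, i ≠ j → threshold α β i ≠ threshold α β j)
    (hδ₀ : ∀ i, α i = -1 → threshold α β i ≠ 0)
    (𝓜 : ∀ t : Test, MessageSpace t) :
    (∃ F : Measure State, IsProbabilityMeasure F ∧ NullSingletonClass F ∧
      ∃ c : ℝ, 0 < c ∧ ∃ η : ℝ, 0 < η ∧ ∀ᶠ ε in 𝓝[>] (0 : ℝ),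
        (linearGame k α β F c ε).privateValue 𝓜 + η ≤
          (linearGame k α β F c ε).publicValue 𝓜) ↔
    ¬ Convex ℝ (launchSet k α β) := by
  have hsmall : ∀ b : ℝ, 0 < b → ∀ᶠ ε in 𝓝[>] (0 : ℝ), ε ∈ Set.Ioo (0 : ℝ) 1 ∧ n * ε < b := by
    intro b hb
    have h2 : ∀ᶠ ε in 𝓝[>] (0 : ℝ), n * ε < b := by
      have : ContinuousAt (fun ε : ℝ => n * ε) 0 := by fun_prop
      exact (this.eventually (gt_mem_nhds (by simpa using hb))).filter_mono nhdsWithin_le_nhds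
    exact (eventually_mem_set.2 (Ioo_mem_nhdsGT zero_lt_one)).and h2
  constructor
  · rintro ⟨F, hF, -, c, hc, η, hη, hev⟩ hΛ
    obtain ⟨ε, hle, hε, hnε⟩ := (hev.and (hsmall η hη)).exists
    have : IsProbabilityMeasure (linearGame k α β F c ε).F := hF
    have := Game.publicValue_le_privateValue_add (G := linearGame k α β F c ε) (𝓜 := 𝓜)
      hα hβ hδ hδ₀ (fun _ => rfl) (fun _ _ => rfl) hc hk hε hΛ
    have hnε' : n * (linearGame k α β F c ε).ε < η := hnε
    linarith
  · intro hΛ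
    obtain ⟨x, y, hx, hxy, hy, hgap, hk₁, hxk, hyk⟩ := exists_gap hα hβ hδ hδ₀ hΛ
    obtain ⟨F, hF, hF0, hsupp, w, hw, hP, hTx, hTy⟩ := exists_two_lump_prior hx hxy hy
    -- Half of the private loss `x / 8 * (y - x)`; the other half covers what mechanical rejections
    -- cost under public messaging.
    have hη : 0 < x / 16 * (y - x) := mul_pos (by linarith) (by linarith)
    refine ⟨F, hF, hF0, x / 4, by linarith, x / 16 * (y - x), hη, ?_⟩
    filter_upwards [hsmall _ hη] with ε hε
    have : IsProbabilityMeasure (linearGame k α β F (x / 4) ε).F := hF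
    have hηx : x / 16 * (y - x) ≤ x / 16 := mul_le_of_le_one_right (by linarith) (by linarith)
    have hmean : ∫ θ, (θ : ℝ) ∂F = (x + y) / 2 := by
      rw [integral_coe_eq_add hw, hTx, hTy, add_div]
    have hn0 : (0 : ℝ) ≤ n * ε := mul_nonneg (Nat.cast_nonneg n) hε.1.1.le
    have hpriv := Game.privateValue_le_of_gap (G := linearGame k α β F (x / 4) ε) (𝓜 := 𝓜)
      hα (fun _ => rfl) (fun _ _ => rfl) hk₁ hk hε.1 hx hxy hy hgap rfl hsupp hmean
      (show n * (ε / 2) ≤ x / 2 by linarith [hε.2])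
    have hpub := Game.le_publicValue_of_gap (G := linearGame k α β F (x / 4) ε) (𝓜 := 𝓜)
      (fun _ => rfl) (fun _ _ => rfl) hk hε.1 hx hxy hy rfl hw hP hTx hTy hxk hyk
      (show n * (ε / 2) ≤ 1 / 2 by linarith [hε.2])
    have hεeq : (linearGame k α β F (x / 4) ε).ε = ε := rfl
    rw [hεeq] at hpub
    linarith [hε.2]
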